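/- Let $\mathbb K$ be a field, $q\in\mathbb K^*$, $\mathcal A$ an associative unital $\mathbb K$-algebra, and $[k]=\{1,\dots,k\}$. A cortege $(I|J)$ is a pair $I\subseteq[m]$, $J\subseteq[n]$ with $|I|=|J|$; $\mathcal E^{m,n}$ is the set of corteges. An $m\times n$ matrix $X=(x_{ij})$ over a $\mathbb K$-algebra is a fine $q$-matrix if, for all $i<\ell$ and $j<k$ (in each relation, for those indices that occur in it), $x_{ij}x_{ik}=q\,x_{ik}x_{ij}$, $x_{ij}x_{\ell j}=q\,x_{\ell j}x_{ij}$, $x_{ik}x_{\ell j}=x_{\ell j}x_{ik}$ and $x_{ij}x_{\ell k}-x_{\ell k}x_{ij}=(q-q^{-1})x_{ik}x_{\ell j}$. For any matrix $X$ over a $\mathbb K$-algebra and $I=\{i_1<\dots<i_k\}$, $J=\{j_1<\dots<j_k\}$, the $q$-minor is $\Delta_{X,q}(I|J)=\sum_{\sigma\in S_k}(-q)^{\ell(\sigma)}x_{i_1j_{\sigma(1)}}\cdots x_{i_kj_{\sigma(k)}}$, where $\ell(\sigma)$ is the number of inversions; $\Delta(\emptyset|\emptyset)=1$. A universal quadratic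 identity is a relation $\sum_{r=1}^N\pm q^{\delta_r}\Delta(I_r|J_r)\Delta(I'_r|J'_r)=0$ with $\delta_r\in\mathbb Z$, in which each of $I_r\cup I'_r$, $I_r\cap I'_r$, $J_r\cup J'_r$, $J_r\cap J'_r$ is independent of $r$, and which holds for the $q$-minors of all $m\times n$ fine $q$-matrices over all $\mathbb K$-algebras, for all $q\in\mathbb K^*$. A QI-function is a function $f:\mathcal E^{m,n}\to\mathcal A$ with $f(\emptyset|\emptyset)=1$ that satisfies, for the given $q$, every universal quadratic identity with $\Delta(I|J)$ replaced by $f(I|J)$. Let $Pint$ be the set of pressed interval corteges: those $(I|J)$ for which $I$ and $J$ are nonempty intervals of integers and $I=[|I|]$ or $J=[|J|]$. Let $f_0:Pint\to\mathcal A^*$ (the invertible elements of $\mathcal A$) satisfy, for all $(I|J),(I'|J')\in Pint$ with $|I|\ge|I'|$, $$f_0(I|J)\,f_0(I'|J')=q^{\beta+\delta-\alpha-\gamma}\,f_0(I'|J')\,f_0(I|J),$$ where $\alpha$ and $\beta$ are the numbers of elements of $I'$ that are less than $\min I$ and greater than $\max I$, respectively, and $\gamma$ and $\delta$ are the numbers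 of elements of $J'$ that are less than $\min J$ and greater than $\max J$, respectively. Theorem. Then $f_0$ extends to a QI-function $f$ on $\mathcal E^{m,n}$. Moreover, such an extension is given by $f(I|J)=\Delta_{P,q}(I|J)$, where $P$ is the following $m\times n$ path matrix. The extended grid has as vertices the pairs $(i,j)\neq(0,0)$ with $0\le i\le m$, $0\le j\le n$, and as directed edges the H-edges $(i,j-1)\to(i,j)$ and the V-edges $(i,j)\to(i-1,j)$ for $i\in[m]$, $j\in[n]$. For $(i,j)\in[m]\times[n]$ and $k=\min(i,j)$ put $\pi(i,j)=(\{i-k+1,\dots,i\}\,|\,\{j-k+1,\dots,j\})$, and let $w(i,j)=f_0(\pi(i,j))$ if $\min(i,j)=1$ and $w(i,j)=f_0(\pi(i-1,j-1))^{-1}f_0(\pi(i,j))$ otherwise. An H-edge from $u$ to $v$ has weight $w(v)$ if $u=(i,0)$ and $w(u)^{-1}w(v)$ otherwise, and a V-edge has weight $1$. The weight of a directed path is the product of the weights of its edges, from left to right, and $P_{ij}$ is the sum of the weights of all directed paths from $(i,0)$ to $(0,j)$. -/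

import Mathlib

universe u v

namespace QuantumMinors

/-! ### Corteges, fine `q`-matrices and quantum minors

The index set `{1, …, k}` is modelled by `Fin k`. -/

/-- A cortege `(I|J)`: a set `I` of row indices and a set `J` of column indices of the same size. -/
@[ext]
structure Cortege (m n : ℕ) where
  rows : Finset (Fin m)
  cols : Finset (Fin n)
  card_eq : rows.card = cols.card

/-- The empty cortege `(∅|∅)`. -/
def Cortege.empty (m n : ℕ) : Cortege m n := ⟨∅, ∅, rfl⟩

/-- A fine `q`-matrix: its entries satisfy Manin's relations. -/
structure IsFine {K : Type u} [Field K] {A : Type v} [Ring A] [Algebra K A] (q : Kˣ)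
    {m n : ℕ} (X : Matrix (Fin m) (Fin n) A) : Prop where
  row : ∀ (i : Fin m) (j k : Fin n), j < k → X i j * X i k = (q : K) • (X i k * X i j)
  col : ∀ (i l : Fin m) (j : Fin n), i < l → X i j * X l j = (q : K) • (X l j * X i j)
  anti : ∀ (i l : Fin m) (j k : Fin n), i < l → j < k → X i k * X l j = X l j * X i k
  diag : ∀ (i l : Fin m) (j k : Fin n), i < l → j < k →
    X i j * X l k - X l k * X i j = ((q : K) - (q : K)⁻¹) • (X i k * X l j)

/-- The length (number of inversions) of a permutation. -/
def permLength {k : ℕ} (σ : Equiv.Perm (Fin k)) : ℕ :=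
  (Finset.univ.filter fun p : Fin k × Fin k => p.1 < p.2 ∧ σ p.2 < σ p.1).card

/-- The `q`-minor `Δ_{X,q}(I|J) = ∑_σ (-q)^{ℓ(σ)} ∏_d x_{i_d, j_{σ(d)}}`, where
`i_1 < ⋯ < i_k` and `j_1 < ⋯ < j_k` are the elements of `I` and `J`, and the factors are
ordered from left to right by increasing `d`. -/
def qMinor {K : Type u} [Field K] {A : Type v} [Ring A] [Algebra K A] (q : Kˣ)
    {m n : ℕ} (X : Matrix (Fin m) (Fin n) A) (c : Cortege m n) : A :=
  ∑ σ : Equiv.Perm (Fin c.rows.card), (-(q : K)) ^ permLength σ •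
    (List.ofFn fun d : Fin c.rows.card =>
      X (c.rows.orderEmbOfFin rfl d) (c.cols.orderEmbOfFin c.card_eq.symm (σ d))).prod

/-! ### Quadratic identities and QI-functions -/

/-- A formal term `± q^δ Δ(I|J) Δ(I'|J')`. -/
structure QTerm (m n : ℕ) where
  sign : ℤˣ
  exponent : ℤ
  left : Cortege m n
  right : Cortege m n

/-- The left-hand side `∑ᵢ signᵢ q^{δᵢ} f(Iᵢ|Jᵢ) f(I'ᵢ|J'ᵢ)` of a formal quadratic
relation, evaluated at a function `f` on corteges. Terms may be repeated. -/
def evalQuadratic {K : Type u} [Field K] {A : Type v} [Ring A] [Algebra K A] (q : Kˣ)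
    {m n : ℕ} (f : Cortege m n → A) (L : List (QTerm m n)) : A :=
  (L.map fun t => (((t.sign : ℤ) : K) * ((q ^ t.exponent : Kˣ) : K)) •
    (f t.left * f t.right)).sum

/-- Homogeneity: each of the sets `I ∪ I'`, `I ∩ I'`, `J ∪ J'`, `J ∩ J'` is the same for all
terms. -/
def IsHomogeneous {m n : ℕ} (L : List (QTerm m n)) : Prop :=
  ∀ s ∈ L, ∀ t ∈ L,
    s.left.rows ∪ s.right.rows = t.left.rows ∪ t.right.rows ∧
    s.left.rows ∩ s.right.rows = t.left.rows ∩ t.right.rows ∧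
    s.left.cols ∪ s.right.cols = t.left.cols ∪ t.right.cols ∧
    s.left.cols ∩ s.right.cols = t.left.cols ∩ t.right.cols

/-- A universal quadratic identity: a homogeneous quadratic relation that holds for the
`q`-minors of every fine `q`-matrix `X` of size `m × n` over every `K`-algebra, for every
`q ∈ K^*`. (The ground field is kept; varying it as well would only leave fewer
universal identities.) -/
def IsUniversalQI (K : Type u) [Field K] {m n : ℕ} (L : List (QTerm m n)) : Prop :=
  IsHomogeneous L ∧
    ∀ (B : Type v) [Ring B] [Algebra K B] (q : Kˣ) (X : Matrix (Fin m) (Fin n) B),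
      IsFine q X → evalQuadratic q (qMinor q X) L = 0

/-- A (normalized) QI-function: it takes the value `1` at `(∅|∅)` and satisfies all
universal quadratic identities. -/
def IsQIFunction {K : Type u} [Field K] {A : Type v} [Ring A] [Algebra K A] (q : Kˣ)
    {m n : ℕ} (f : Cortege m n → A) : Prop :=
  f (Cortege.empty m n) = 1 ∧
    ∀ L : List (QTerm m n), IsUniversalQI.{u, v} K L → evalQuadratic q f L = 0

/-! ### Pressed interval corteges and their quasi-commutation relations -/

/-- Nonempty intervals `[a..b]`, `a ≤ b`. -/
def IsInterval {k : ℕ} (S : Finset (Fin k)) : Prop :=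
  ∃ a b : Fin k, a ≤ b ∧ S = Finset.Icc a b

/-- `S` consists of the first `|S|` indices. -/
def IsInitial {k : ℕ} (S : Finset (Fin k)) : Prop :=
  ∀ x : Fin k, x ∈ S ↔ (x : ℕ) < S.card

/-- Pressed interval corteges: both sets are intervals, and at least one is initial. -/
def Cortege.IsPressed {m n : ℕ} (c : Cortege m n) : Prop :=
  IsInterval c.rows ∧ IsInterval c.cols ∧ (IsInitial c.rows ∨ IsInitial c.cols)

/-- The set `Pint` of pressed interval corteges. -/
def Pint (m n : ℕ) : Type := {c : Cortege m n // c.IsPressed}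

/-- The number of elements of `T` smaller than `min S`. -/
def numBelow {k : ℕ} (S T : Finset (Fin k)) : ℕ :=
  (T.filter fun t => ∀ s ∈ S, t < s).card

/-- The number of elements of `T` greater than `max S`. -/
def numAbove {k : ℕ} (S T : Finset (Fin k)) : ℕ :=
  (T.filter fun t => ∀ s ∈ S, s < t).card

/-- The exponent `β + δ - α - γ` in the quasi-commutation relation of `(I|J)` and `(I'|J')`,
when `|I| ≥ |I'|`. -/
def qcExponent {m n : ℕ} (c c' : Cortege m n) : ℤ :=
  (numAbove c.rows c'.rows : ℤ) + numAbove c.cols c'.cols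
    - numBelow c.rows c'.rows - numBelow c.cols c'.cols

/-- The quasi-commutation relations for a function on the pressed interval corteges. -/
def QuasiCommutes {K : Type u} [Field K] {A : Type v} [Ring A] [Algebra K A] (q : Kˣ)
    {m n : ℕ} (f₀ : Pint m n → Aˣ) : Prop :=
  ∀ c c' : Pint m n, c'.1.rows.card ≤ c.1.rows.card →
    (f₀ c : A) * (f₀ c' : A) =
      ((q ^ qcExponent c.1 c'.1 : Kˣ) : K) • ((f₀ c' : A) * (f₀ c : A))

/-! ### The extended grid and its path matrix -/

/-- Vertices of the extended `m × n` grid: the sources `r_i = (i, 0)`, the sinks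
`c_j = (0, j)` and the inner vertices `(i, j)`, with `1 ≤ i ≤ m` and `1 ≤ j ≤ n`
(here `i - 1 : Fin m` and `j - 1 : Fin n`). -/
inductive GridVertex (m n : ℕ) : Type
  | source (i : Fin m) : GridVertex m n
  | sink (j : Fin n) : GridVertex m n
  | inner (i : Fin m) (j : Fin n) : GridVertex m n
  deriving DecidableEq, Fintype

/-- H-edges `(i, j - 1) → (i, j)`. -/
inductive HEdge {m n : ℕ} : GridVertex m n → GridVertex m n → Prop
  | fromSource (i : Fin m) (j : Fin n) (h : (j : ℕ) = 0) : HEdge (.source i) (.inner i j)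
  | inner (i : Fin m) (j j' : Fin n) (h : (j' : ℕ) = j + 1) : HEdge (.inner i j) (.inner i j')

/-- V-edges `(i, j) → (i - 1, j)`. -/
inductive VEdge {m n : ℕ} : GridVertex m n → GridVertex m n → Prop
  | toSink (i : Fin m) (j : Fin n) (h : (i : ℕ) = 0) : VEdge (.inner i j) (.sink j)
  | inner (i i' : Fin m) (j : Fin n) (h : (i : ℕ) = i' + 1) : VEdge (.inner i j) (.inner i' j)

/-- The edges of the extended grid. -/
def GridEdge {m n : ℕ} (x y : GridVertex m n) : Prop := HEdge x y ∨ VEdge x y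

open Classical in
/-- The set `Φ(i|j)` of directed paths from the source `r_i` to the sink `c_j`, each given by
its sequence of (distinct) vertices. -/
noncomputable def gridPaths {m n : ℕ} (i : Fin m) (j : Fin n) :
    Finset {p : List (GridVertex m n) // p.Nodup} :=
  Finset.univ.filter fun p => p.1.IsChain GridEdge ∧
    p.1.head? = some (.source i) ∧ p.1.getLast? = some (.sink j)

open Classical in
/-- The weight of an edge `x → y`, for weights `w` of the inner vertices: `w(y)` for an H-edge
leaving a source, `w(x)⁻¹ w(y)` for an H-edge between inner vertices, `1` for a V-edge. -/
noncomputable def edgeWeight {A : Type v} [Ring A] {m n : ℕ} (w : Fin m → Fin n → Aˣ) :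
    GridVertex m n → GridVertex m n → Aˣ
  | .source _, .inner i j => w i j
  | .inner i j, .inner i' j' =>
      if HEdge (.inner i j) (.inner i' j' : GridVertex m n) then (w i j)⁻¹ * w i' j' else 1
  | _, _ => 1

/-- The weight of a path: the product of the weights of its edges, from left to right. -/
noncomputable def pathWeight {A : Type v} [Ring A] {m n : ℕ} (w : Fin m → Fin n → Aˣ)
    (p : List (GridVertex m n)) : Aˣ :=
  (List.zipWith (edgeWeight w) p p.tail).prod

/-- The path matrix of the extended grid: its entry at `(i, j)` is the sum of the weights of
the directed paths from `r_i` to `c_j`. -/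
noncomputable def pathMatrix {A : Type v} [Ring A] {m n : ℕ} (w : Fin m → Fin n → Aˣ) :
    Matrix (Fin m) (Fin n) A :=
  Matrix.of fun i j => ∑ p ∈ gridPaths i j, (pathWeight w p.1 : A)

/-! ### Vertex weights from the values on pressed interval corteges -/

/-- The interval of the `d + 1` indices ending with `i`. -/
def intervalTo {k : ℕ} (i : Fin k) (d : ℕ) : Finset (Fin k) :=
  Finset.Icc ⟨(i : ℕ) - d, lt_of_le_of_lt (Nat.sub_le _ _) i.2⟩ i

theorem intervalTo_card {k : ℕ} (i : Fin k) (d : ℕ) (h : d ≤ i) :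
    (intervalTo i d).card = d + 1 := by
  simp only [intervalTo, Fin.card_Icc]
  omega

theorem intervalTo_isInterval {k : ℕ} (i : Fin k) (d : ℕ) : IsInterval (intervalTo i d) :=
  ⟨_, i, by simp [Fin.le_def], rfl⟩

theorem intervalTo_isInitial {k : ℕ} (i : Fin k) (d : ℕ) (h : d = i) :
    IsInitial (intervalTo i d) := by
  intro x
  rw [intervalTo_card i d h.le]
  simp only [intervalTo, Finset.mem_Icc, Fin.le_def]
  omega

/-- The pressed interval cortege `π(i,j) = ([i-k+1..i] | [j-k+1..j])`, `k = min(i,j)`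
(in terms of indices starting with `1`). -/
def pressedAt {m n : ℕ} (i : Fin m) (j : Fin n) : Pint m n :=
  ⟨⟨intervalTo i (min (i : ℕ) j), intervalTo j (min (i : ℕ) j), by
      rw [intervalTo_card _ _ (min_le_left _ _), intervalTo_card _ _ (min_le_right _ _)]⟩,
    intervalTo_isInterval _ _, intervalTo_isInterval _ _, by
      rcases le_total (i : ℕ) j with h | h
      · exact Or.inl (intervalTo_isInitial _ _ (min_eq_left h))
      · exact Or.inr (intervalTo_isInitial _ _ (min_eq_right h))⟩

/-- The weight of the inner vertex `(i,j)`: `f₀(π(i-1,j-1))⁻¹ f₀(π(i,j))` when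
`min(i,j) > 1`, and `f₀(π(i,j)) = f₀({i}|{j})` when `min(i,j) = 1` (in terms of indices
starting with `1`). -/
def vertexWeight {A : Type v} [Ring A] {m n : ℕ} (f₀ : Pint m n → Aˣ)
    (i : Fin m) (j : Fin n) : Aˣ :=
  if 0 < (i : ℕ) ∧ 0 < (j : ℕ) then
    (f₀ (pressedAt ⟨(i : ℕ) - 1, lt_of_le_of_lt (Nat.sub_le _ _) i.2⟩
      ⟨(j : ℕ) - 1, lt_of_le_of_lt (Nat.sub_le _ _) j.2⟩))⁻¹ * f₀ (pressedAt i j)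
  else f₀ (pressedAt i j)

end QuantumMinors

open QuantumMinors

/-! The `q`-minors of a fine `q`-matrix satisfy every universal quadratic identity by definition. So
it suffices that the path matrix `P` is fine and that its minors on pressed interval corteges are
the prescribed values.

Weights. A vertex weight is a quotient of two neighbouring values of `f₀` on a diagonal, so the
commutation exponent of two weights is a mixed second difference of the exponents of `f₀`. It equals
1 for two vertices in the same row or column, taken in increasing order, and the weights commute
otherwise (`QuasiCommutes.partFine`). Hence the matrix of weights satisfies Manin's relations with
all diagonal commutators switched off.

Fineness. `P` arises from the matrix of weights by Gaussian elimination run backwards: a step at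
`(r, c)`, with invertible pivot `p`, adds `X i c * p⁻¹ * X r j` to the entries strictly below and to
the right. Since `p (b p⁻¹ a) - (b p⁻¹ a) p = (q - q⁻¹) a b` for `b` in the pivot column and `a` in
the pivot row, the step switches on exactly the commutator at `(r, c)` (`PartFine.pivot`). After
steps at all positions, from bottom to top and from right to left, the matrix is fine. It is the
path matrix, because the steps in one row extend paths through that row
(`stage_last_eq_pathMatrix`).

Minors. In the `q`-exterior algebra over `A` a minor is a coefficient of a product of row vectors
(`qMinor_eq_listMinor`). A pivot step adds left multiples of the pivot row, or of a part of it, to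
lower rows. The pivot row has square zero and can be moved past the other factors, so a step either
preserves a minor or splits off the pivot (`listMinor_pivot_left`, `listMinor_pivot_corner`,
`listMinor_pivot_above`). An interval minor thus becomes the product of the weights on its diagonal
once its top row has been processed. Steps in higher rows do not change it if it starts in the first
column, and there are none if it starts in the first row; this is where pressedness enters. The
product of weights telescopes to the value of `f₀`. -/

namespace QuantumMinors

/-! ### Pivot steps and Manin's relations -/

section Pivot

variable {K : Type u} [Field K] {A : Type v} [Ring A] [Algebra K A]

/-- Lets a relation between two adjacent factors act inside a right-nested monomial, so that `simp`
can bring monomials to a fixed order of factors. -/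
theorem mul_lift {a b d : A} (h : a * b = d) (z : A) : a * (b * z) = d * z := by
  rw [← mul_assoc, h]

theorem swap_unit_inv {s : K} {a : A} (p : Aˣ) (h : (p : A) * a = s • (a * p)) :
    a * ((p⁻¹ : Aˣ) : A) = s • (((p⁻¹ : Aˣ) : A) * a) := by
  have h1 : ((p⁻¹ : Aˣ) : A) * ((p : A) * a) * ((p⁻¹ : Aˣ) : A)
      = s • (((p⁻¹ : Aˣ) : A) * (a * p) * ((p⁻¹ : Aˣ) : A)) := by
    rw [h, mul_smul_comm, smul_mul_assoc]
  simpa [mul_assoc] using h1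

theorem swap_symm {s : K} {a b : A} (hs : s ≠ 0) (h : a * b = s • (b * a)) :
    b * a = s⁻¹ • (a * b) := by
  rw [h, smul_smul, inv_mul_cancel₀ hs, one_smul]

/-- Manin's relations where the diagonal commutators are switched on only at the positions
in `S`. -/
structure PartFine (q : K) {ι κ : Type*} [LinearOrder ι] [LinearOrder κ] (S : Set (ι × κ))
    (X : ι → κ → A) : Prop where
  row : ∀ i {j k}, j < k → X i j * X i k = q • (X i k * X i j)
  col : ∀ {i l} j, i < l → X i j * X l j = q • (X l j * X i j)
  anti : ∀ {i l j k}, i < l → j < k → X i k * X l j = X l j * X i k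
  diag : ∀ {i l j k}, i < l → j < k → (i, j) ∈ S →
    X i j * X l k = X l k * X i j + (q - q⁻¹) • (X i k * X l j)
  comm : ∀ {i l j k}, i < l → j < k → (i, j) ∉ S → X i j * X l k = X l k * X i j

variable {q : K} {ι κ : Type*} [LinearOrder ι] [LinearOrder κ]

/-- Transposition reverses the antidiagonal product in `diag`, which is harmless by `anti`. This
symmetry halves the case analysis for a pivot step. -/
theorem PartFine.transpose {S : Set (ι × κ)} {X : ι → κ → A} (h : PartFine q S X) :
    PartFine q (Prod.swap ⁻¹' S) (fun j i => X i j) where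
  row _ _ _ hjk := h.col _ hjk
  col _ hjk := h.row _ hjk
  anti h1 h2 := (h.anti h2 h1).symm
  diag h1 h2 h3 := by rw [h.diag h2 h1 h3, h.anti h2 h1]
  comm h1 h2 h3 := h.comm h2 h1 h3

/-- Addition of `X i c * p⁻¹ * X r j` to the entries strictly below and to the right
of `(r, c)`. -/
def pivot (r : ι) (c : κ) (p : Aˣ) (X : ι → κ → A) (i : ι) (j : κ) : A :=
  if r < i ∧ c < j then X i j + X i c * (((p⁻¹ : Aˣ) : A) * X r j) else X i j

theorem pivot_of_lt {r i : ι} {c j : κ} (p : Aˣ) (X : ι → κ → A) (hi : r < i) (hj : c < j) :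
    pivot r c p X i j = X i j + X i c * (((p⁻¹ : Aˣ) : A) * X r j) := if_pos ⟨hi, hj⟩

theorem pivot_of_row_le {r i : ι} {c j : κ} (p : Aˣ) (X : ι → κ → A) (hi : i ≤ r) :
    pivot r c p X i j = X i j := if_neg fun h => absurd h.1 hi.not_gt

theorem pivot_of_col_le {r i : ι} {c j : κ} (p : Aˣ) (X : ι → κ → A) (hj : j ≤ c) :
    pivot r c p X i j = X i j := if_neg fun h => absurd h.2 hj.not_gt

/-- `(r, c)` is a maximal element of the complement of the upper set `S`. -/
structure IsCorner (S : Set (ι × κ)) (r : ι) (c : κ) : Prop where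
  not_mem : ∀ {i j}, i ≤ r → j ≤ c → (i, j) ∉ S
  mem_right : ∀ {i j}, r ≤ i → c < j → (i, j) ∈ S
  mem_below : ∀ {i j}, r < i → c ≤ j → (i, j) ∈ S

theorem IsCorner.transpose {S : Set (ι × κ)} {r : ι} {c : κ} (h : IsCorner S r c) :
    IsCorner (Prod.swap ⁻¹' S) c r where
  not_mem h1 h2 := h.not_mem h2 h1
  mem_right h1 h2 := h.mem_below h2 h1
  mem_below h1 h2 := h.mem_right h2 h1

variable {S : Set (ι × κ)} {X : ι → κ → A} {r : ι} {c : κ} {p : Aˣ}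

namespace PartFine

theorem row_inv (h : PartFine q S X) (hp : X r c = p) {j : κ} (hj : c < j) :
    X r j * ((p⁻¹ : Aˣ) : A) = q • (((p⁻¹ : Aˣ) : A) * X r j) :=
  swap_unit_inv p (by rw [← hp]; exact h.row r hj)

theorem col_inv (h : PartFine q S X) (hp : X r c = p) {i : ι} (hi : r < i) :
    X i c * ((p⁻¹ : Aˣ) : A) = q • (((p⁻¹ : Aˣ) : A) * X i c) :=
  swap_unit_inv p (by rw [← hp]; exact h.col c hi)

/-- The correction term is symmetric: moving `p⁻¹` past `X i c` or past `X r j` costs the same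
factor `q`, and these two entries commute. -/
theorem pivot_transpose (h : PartFine q S X) (hp : X r c = p) :
    (fun j i => pivot r c p X i j) = pivot c r p (fun j i => X i j) := by
  funext j i
  by_cases hij : r < i ∧ c < j
  · rw [pivot_of_lt p X hij.1 hij.2, pivot_of_lt p _ hij.2 hij.1, add_right_inj,
      ← mul_assoc, ← mul_assoc, h.row_inv hp hij.2, h.col_inv hp hij.1,
      smul_mul_assoc, smul_mul_assoc, mul_assoc, mul_assoc, h.anti hij.1 hij.2]
  · rw [pivot, pivot, if_neg hij, if_neg (fun h => hij h.symm)]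

theorem comm_inv (h : PartFine q S X) (hS : IsCorner S r c) (hp : X r c = p) {i : ι} {j : κ}
    (hi : r < i) (hj : c < j) : Commute (X i j) ((p⁻¹ : Aˣ) : A) := by
  apply Commute.units_inv_right
  rw [← hp]
  exact (h.comm hi hj (hS.not_mem le_rfl le_rfl)).symm

theorem pivot_row (h : PartFine q S X) (hS : IsCorner S r c) (hq : q ≠ 0) (hp : X r c = p)
    (i : ι) {j k : κ} (hjk : j < k) :
    pivot r c p X i j * pivot r c p X i k = q • (pivot r c p X i k * pivot r c p X i j) := by
  rcases le_or_gt i r with hi | hi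
  · simp only [pivot_of_row_le p X hi, h.row i hjk]
  rcases le_or_gt k c with hk | hk
  · simp only [pivot_of_col_le p X hk, pivot_of_col_le p X (hjk.le.trans hk), h.row i hjk]
  have hbu := h.col_inv hp hi
  have hau := h.row_inv hp hk
  have hab := h.anti hi hk
  rw [pivot_of_lt p X hi hk]
  rcases lt_trichotomy j c with hj | rfl | hj
  · rw [pivot_of_col_le p X hj.le]
    -- To the left of the pivot column, `X i j` commutes with `p` and with `X r k`; the required `q`
    -- comes from `X i c` alone.
    have hxp : Commute (X i j) ((p⁻¹ : Aˣ) : A) := by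
      apply Commute.units_inv_right
      rw [← hp]
      exact (h.anti hi hj).symm
    have hxa : Commute (X i j) (X r k) := (h.anti hi hjk).symm
    rw [mul_add, h.row i hjk, ← mul_assoc, h.row i hj, smul_mul_assoc, mul_assoc,
      (hxp.mul_right hxa).eq, add_mul, smul_add, mul_assoc, mul_assoc, mul_assoc]
  · rw [pivot_of_col_le p X le_rfl, mul_add, h.row i hjk, add_mul, smul_add, add_right_inj,
      mul_assoc, mul_assoc, hab, ← mul_assoc _ _ (X r k), hbu, smul_mul_assoc, mul_smul_comm,
      mul_assoc]
  · rw [pivot_of_lt p X hi hj]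
    have hau' := h.row_inv hp hj
    have hab' := h.anti hi hj
    have haa := h.row r hjk
    have hd := h.diag hi hjk (hS.mem_right le_rfl hj)
    have hxj := (h.comm_inv hS hp hi hj).eq
    have hxk := (h.comm_inv hS hp hi hk).eq
    have hbj := swap_symm hq (h.row i hj)
    have hbk := swap_symm hq (h.row i hk)
    have hakj := h.anti hi hjk
    have hxx := h.row i hjk
    -- The rules move `p⁻¹` to the left and the entries of row `r` to the right; comparing
    -- coefficients leaves identities between scalars.
    simp only [mul_add, add_mul, mul_assoc, mul_lift hbu, mul_lift hau,
      mul_lift hau', mul_lift hab, mul_lift hab', haa, hd,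
      mul_lift hxj, mul_lift hxk, mul_lift hbj, mul_lift hbk, hakj,
      hxx,
      smul_mul_assoc, mul_smul_comm, smul_add, smul_smul]
    match_scalars <;> field_simp <;> ring

theorem pivot_anti_low (h : PartFine q S X) (hS : IsCorner S r c) (hq : q ≠ 0)
    (hp : X r c = p) {i l : ι} {j k : κ} (hil : i < l) (hjk : j < k) (hj : c < j) :
    pivot r c p X i k * pivot r c p X l j = pivot r c p X l j * pivot r c p X i k := by
  have hk := hj.trans hjk
  rcases le_or_gt l r with hl | hl
  · simp only [pivot_of_row_le p X hl, pivot_of_row_le p X (hil.le.trans hl), h.anti hil hjk]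
  rw [pivot_of_lt p X hl hj]
  have hbu := h.col_inv hp hl
  have hab := h.anti hl hk
  rcases lt_trichotomy i r with hi | rfl | hi
  · rw [pivot_of_row_le p X hi.le]
    have h1 : Commute (X i k) (X l j) := h.anti hil hjk
    have h2 : Commute (X i k) (X l c) := h.anti hil hk
    have h3 : Commute (X i k) ((p⁻¹ : Aˣ) : A) := by
      apply Commute.units_inv_right
      rw [← hp]
      exact h.anti hi hk
    have h4 : Commute (X i k) (X r j) := h.anti hi hjk
    exact (h1.add_right (h2.mul_right (h3.mul_right h4))).eq
  · rw [pivot_of_row_le p X le_rfl]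
    have h1 := h.anti hil hjk
    have hau := h.row_inv hp hk
    have haa := h.row i hjk
    simp only [mul_add, add_mul, mul_assoc, h1, mul_lift hab, mul_lift hau, haa,
      smul_mul_assoc, mul_smul_comm]
  · rw [pivot_of_lt p X hi hk]
    have hau := h.row_inv hp hk
    have hau' := h.row_inv hp hj
    have hbu' := h.col_inv hp hi
    have hbb := h.col c hil
    have haa := h.row r hjk
    have hxik := (h.comm_inv hS hp hi hk).eq
    have hxlj := (h.comm_inv hS hp hl hj).eq
    have h1 := h.anti hil hjk
    have h2 := h.anti hil hk
    have h3 := h.anti hil hj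
    have h4 := h.diag hi hjk (hS.mem_right le_rfl hj)
    have h5 := h.anti hl hjk
    have h6 := h.diag hil hj (hS.mem_below hi le_rfl)
    -- The relation at `(i, c)` is oriented so as to move the entries of the pivot column to the
    -- left.
    have h6' := eq_sub_of_add_eq h6.symm
    have h7 := h.anti hi hj
    have h8 := h.anti hi hjk
    simp only [mul_add, add_mul, mul_assoc, mul_lift hbu, mul_lift hbu',
      mul_lift hau, mul_lift hau', mul_lift hbb, haa,
      mul_lift hxik, mul_lift hxlj, h1, mul_lift h2,
      h3, h4, h5, mul_lift h6', mul_lift hab,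
      mul_lift h7, h8,
      mul_sub, sub_mul, smul_mul_assoc, mul_smul_comm, smul_add, smul_sub, smul_smul]
    match_scalars <;> field_simp <;> ring

/-- The source of the new commutator: for `b = X l c` and `a = X r k` one has `p (b p⁻¹ a) = q b a`
and `(b p⁻¹ a) p = q⁻¹ b a`, while the old entry commutes with `p`. -/
theorem pivot_diag_corner (h : PartFine q S X) (hS : IsCorner S r c) (hq : q ≠ 0)
    (hp : X r c = p) {l : ι} {k : κ} (hl : r < l) (hk : c < k) :
    X r c * pivot r c p X l k = pivot r c p X l k * X r c + (q - q⁻¹) • (X r k * X l c) := by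
  rw [pivot_of_lt p X hl hk]
  have h1 := h.comm hl hk (hS.not_mem le_rfl le_rfl)
  have h2 := h.col c hl
  have h3 := swap_symm hq (h.row r hk)
  have h4 := h.anti hl hk
  rw [hp] at h1 h2 h3 ⊢
  simp only [mul_add, add_mul, mul_assoc, h1, mul_lift h2, h3, h4, Units.inv_mul_cancel_left,
    Units.mul_inv_cancel_left, smul_mul_assoc, mul_smul_comm]
  match_scalars <;> field_simp <;> ring

theorem pivot_diag_low (h : PartFine q S X) (hS : IsCorner S r c) (hq : q ≠ 0)
    (hp : X r c = p) {i l : ι} {j k : κ} (hil : i < l) (hjk : j < k) (hi : r ≤ i) (hj : c < j) :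
    pivot r c p X i j * pivot r c p X l k = pivot r c p X l k * pivot r c p X i j
      + (q - q⁻¹) • (pivot r c p X i k * pivot r c p X l j) := by
  have hk := hj.trans hjk
  have hl := hi.trans_lt hil
  have hau := h.row_inv hp hk
  have hau' := h.row_inv hp hj
  have hbu := h.col_inv hp hl
  have hab := h.anti hl hk
  have hab' := h.anti hl hj
  have haa := h.row r hjk
  have hd := h.diag hil hjk (hS.mem_right hi hj)
  rw [pivot_of_lt p X hl hj, pivot_of_lt p X hl hk]
  rcases hi.eq_or_lt with rfl | hi
  · rw [pivot_of_row_le p X le_rfl, pivot_of_row_le p X le_rfl]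
    simp only [mul_add, add_mul, mul_assoc, mul_lift hau, mul_lift hau',
      mul_lift hbu, mul_lift hab, mul_lift hab', haa, hd,
      smul_mul_assoc, mul_smul_comm, smul_add, smul_smul]
    match_scalars <;> field_simp <;> ring
  · rw [pivot_of_lt p X hi hj, pivot_of_lt p X hi hk]
    have hbu' := h.col_inv hp hi
    have hbb := h.col c hil
    have hxij := (h.comm_inv hS hp hi hj).eq
    have hxik := (h.comm_inv hS hp hi hk).eq
    have hxlk := (h.comm_inv hS hp hl hk).eq
    have h1 := h.anti hil hj
    have h2 := h.anti hil hk
    have h3 := h.anti hi hjk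
    have h5 := h.anti hl hjk
    have h6 := h.diag hl hjk (hS.mem_right le_rfl hj)
    have h7 := eq_sub_of_add_eq (h.diag hil hk (hS.mem_below hi le_rfl)).symm
    have h9 := h.anti hi hk
    have h10 := h.anti hil hjk
    simp only [mul_add, add_mul, mul_assoc, mul_lift hbu, mul_lift hbu',
      mul_lift hau, mul_lift hau', mul_lift hbb, haa,
      mul_lift hxik, mul_lift hxij, mul_lift hxlk,
      mul_lift h1, h2, mul_lift h2, hd,
      h3, h5, h6, mul_lift h7, mul_lift hab,
      mul_lift hab', mul_lift h9, h10,
      mul_sub, sub_mul, smul_mul_assoc, mul_smul_comm, smul_add, smul_sub, smul_smul]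
    match_scalars <;> field_simp <;> ring

theorem pivot_diag (h : PartFine q S X) (hS : IsCorner S r c) (hq : q ≠ 0)
    (hp : X r c = p) {i l : ι} {j k : κ} (hil : i < l) (hjk : j < k) (hi : r ≤ i) (hj : c ≤ j) :
    pivot r c p X i j * pivot r c p X l k = pivot r c p X l k * pivot r c p X i j
      + (q - q⁻¹) • (pivot r c p X i k * pivot r c p X l j) := by
  rcases hj.lt_or_eq with hj | rfl
  · exact h.pivot_diag_low hS hq hp hil hjk hi hj
  rcases hi.lt_or_eq with hi | rfl
  · have := h.transpose.pivot_diag_low hS.transpose hq hp hjk hil le_rfl hi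
    rw [← h.pivot_transpose hp] at this
    rw [this, add_right_inj]
    congr 1
    have := h.transpose.pivot_anti_low hS.transpose hq hp hjk hil hi
    rw [← h.pivot_transpose hp] at this
    exact this
  · rw [pivot_of_row_le p X le_rfl, pivot_of_row_le p X le_rfl, pivot_of_col_le p X le_rfl]
    exact h.pivot_diag_corner hS hq hp hil hjk

theorem pivot_anti (h : PartFine q S X) (hS : IsCorner S r c) (hq : q ≠ 0)
    (hp : X r c = p) {i l : ι} {j k : κ} (hil : i < l) (hjk : j < k) :
    pivot r c p X i k * pivot r c p X l j = pivot r c p X l j * pivot r c p X i k := by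
  rcases lt_or_ge c j with hj | hj
  · exact h.pivot_anti_low hS hq hp hil hjk hj
  rcases lt_or_ge r i with hi | hi
  · have := h.transpose.pivot_anti_low hS.transpose hq hp hjk hil hi
    rw [← h.pivot_transpose hp] at this
    exact this.symm
  · rw [pivot_of_row_le p X hi, pivot_of_col_le p X hj, h.anti hil hjk]

theorem pivot_diag_above (h : PartFine q S X) (hp : X r c = p)
    {i l : ι} {j k : κ} (hil : i < l) (hjk : j < k) (hi : i < r) (hj : c < j) (hS : (i, j) ∈ S) :
    pivot r c p X i j * pivot r c p X l k = pivot r c p X l k * pivot r c p X i j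
      + (q - q⁻¹) • (pivot r c p X i k * pivot r c p X l j) := by
  simp only [pivot_of_row_le p X hi.le]
  rcases le_or_gt l r with hl | hl
  · simp only [pivot_of_row_le p X hl, h.diag hil hjk hS]
  have hk := hj.trans hjk
  rw [pivot_of_lt p X hl hk, pivot_of_lt p X hl hj]
  have hb : Commute (X i j) (X l c) := h.anti hil hj
  have hb' : Commute (X i k) (X l c) := h.anti hil hk
  have hu : Commute (X i j) ((p⁻¹ : Aˣ) : A) := by
    apply Commute.units_inv_right
    rw [← hp]
    exact h.anti hi hj
  have hu' : Commute (X i k) ((p⁻¹ : Aˣ) : A) := by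
    apply Commute.units_inv_right
    rw [← hp]
    exact h.anti hi hk
  have hd := h.diag hi hjk hS
  simp only [mul_add, add_mul, mul_assoc, h.diag hil hjk hS, mul_lift hb.eq, mul_lift hb'.eq,
    mul_lift hu.eq, mul_lift hu'.eq, hd, mul_smul_comm, smul_add]
  abel

theorem pivot_comm_left (h : PartFine q S X) (hS : IsCorner S r c) (hq : q ≠ 0) (hp : X r c = p)
    {i l : ι} {j k : κ} (hil : i < l) (hjk : j < k) (hi : i < r) (hij : (i, j) ∉ S) :
    pivot r c p X i j * pivot r c p X l k = pivot r c p X l k * pivot r c p X i j := by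
  rw [pivot_of_row_le p X hi.le]
  by_cases hlk : r < l ∧ c < k
  swap
  · rw [pivot, if_neg hlk, h.comm hil hjk hij]
  rw [pivot_of_lt p X hlk.1 hlk.2]
  have h1 : Commute (X i j) (X l k) := h.comm hil hjk hij
  have h2 : Commute (X i j) (X r k) := h.comm hi hjk hij
  refine (h1.add_right ?_).eq
  rcases lt_trichotomy j c with hj | rfl | hj
  · have h3 : Commute (X i j) (X l c) := h.comm hil hj hij
    have h4 : Commute (X i j) ((p⁻¹ : Aˣ) : A) := by
      apply Commute.units_inv_right
      rw [← hp]
      exact h.comm hi hj hij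
    exact h3.mul_right (h4.mul_right h2)
  -- In the pivot column the factor `q` from passing `X l j` cancels the `q⁻¹` from passing `p⁻¹`.
  · have h3 := h.col j hil
    have h4 := h.col j hi
    have h5 := swap_unit_inv p (by rw [← hp]; exact swap_symm hq h4)
    have h6 : X i j * (X l j * (((p⁻¹ : Aˣ) : A) * X r k))
        = X l j * (((p⁻¹ : Aˣ) : A) * X r k) * X i j := by
      rw [mul_lift h3, smul_mul_assoc, mul_assoc, mul_lift h5, smul_mul_assoc, mul_smul_comm,
        smul_smul, mul_inv_cancel₀ hq, one_smul, mul_assoc, h2.eq, mul_assoc, mul_assoc]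
    exact h6
  · have h3 : Commute (X i j) (X l c) := h.anti hil hj
    have h4 : Commute (X i j) ((p⁻¹ : Aˣ) : A) := by
      apply Commute.units_inv_right
      rw [← hp]
      exact h.anti hi hj
    exact h3.mul_right (h4.mul_right h2)

/-- By the corner condition, a position of `S` not weakly below and to the right of `(r, c)` is
strictly above and right of it or strictly below and left of it. The second case is the transpose of
the first. -/
protected theorem pivot (h : PartFine q S X) (hS : IsCorner S r c) (hq : q ≠ 0)
    (hp : X r c = p) : PartFine q (insert (r, c) S) (pivot r c p X) where
  row i _ _ hjk := h.pivot_row hS hq hp i hjk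
  col j hil := by
    have := h.transpose.pivot_row hS.transpose hq hp j hil
    rw [← h.pivot_transpose hp] at this
    exact this
  anti hil hjk := h.pivot_anti hS hq hp hil hjk
  diag {i l j k} hil hjk hij := by
    by_cases hle : r ≤ i ∧ c ≤ j
    · exact h.pivot_diag hS hq hp hil hjk hle.1 hle.2
    have hmem : (i, j) ∈ S := by
      rcases hij with hij | hij
      · cases hij
        exact absurd ⟨le_rfl, le_rfl⟩ hle
      · exact hij
    rcases lt_or_ge i r with hi | hi
    · have hj : c < j := lt_of_not_ge fun hj => hS.not_mem hi.le hj hmem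
      exact h.pivot_diag_above hp hil hjk hi hj hmem
    · have hj : j < c := lt_of_not_ge fun hj => hle ⟨hi, hj⟩
      have hi' : r < i := lt_of_not_ge fun hi => hS.not_mem hi hj.le hmem
      have h1 := h.transpose.pivot_diag_above hp hjk hil hj hi' hmem
      rw [← h.pivot_transpose hp] at h1
      rw [h1, h.pivot_anti hS hq hp hil hjk]
  comm {i l j k} hil hjk hij := by
    have hij' : (i, j) ∉ S := fun h => hij (Or.inr h)
    rcases lt_or_ge i r with hi | hi
    · exact h.pivot_comm_left hS hq hp hil hjk hi hij'
    · have hj : j < c := by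
        by_contra! hj
        rcases hj.lt_or_eq with hj | rfl
        · exact hij' (hS.mem_right hi hj)
        rcases hi.lt_or_eq with hi | rfl
        · exact hij' (hS.mem_below hi le_rfl)
        · exact hij (Or.inl rfl)
      have h1 := h.transpose.pivot_comm_left hS.transpose hq hp hjk hil hj hij'
      rw [← h.pivot_transpose hp] at h1
      exact h1

end PartFine
end Pivot

/-! ### Products of factors `ν + a * θ` with `θ * θ = 0` -/

section Normalize

variable {R : Type*} [Ring R] {θ : R}

/-- `u` moves past `θ`: `u * θ` is a right multiple of `θ`. -/
def Normalizes (θ u : R) : Prop := ∃ u', u * θ = θ * u'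

theorem Normalizes.mul {u v : R} (hu : Normalizes θ u) (hv : Normalizes θ v) :
    Normalizes θ (u * v) := by
  obtain ⟨u', hu⟩ := hu
  obtain ⟨v', hv⟩ := hv
  exact ⟨u' * v', by rw [mul_assoc, hv, ← mul_assoc, hu, mul_assoc]⟩

theorem Normalizes.add {u v : R} (hu : Normalizes θ u) (hv : Normalizes θ v) :
    Normalizes θ (u + v) := by
  obtain ⟨u', hu⟩ := hu
  obtain ⟨v', hv⟩ := hv
  exact ⟨u' + v', by rw [add_mul, hu, hv, mul_add]⟩

theorem Normalizes.one : Normalizes θ 1 := ⟨1, by simp⟩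

theorem Normalizes.sum {α : Type*} {s : Finset α} {f : α → R}
    (h : ∀ i ∈ s, Normalizes θ (f i)) : Normalizes θ (∑ i ∈ s, f i) :=
  Finset.sum_induction f _ (fun _ _ => Normalizes.add) ⟨0, by simp⟩ h

theorem Normalizes.mul_self_eq_zero {u : R} (hu : Normalizes θ u) (h : θ * θ = 0) :
    θ * u * θ = 0 := by
  obtain ⟨u', hu⟩ := hu
  rw [mul_assoc, hu, ← mul_assoc, h, zero_mul]

variable {α : Type*} (ν a : α → R)

/-- A term that uses some `a i * θ` contains two factors `θ` with only normalizing elements between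
them. These can be brought together, so the term vanishes. -/
theorem mul_prod_add_mul_of_normalizes (h : θ * θ = 0) (L : List α)
    (hν : ∀ i ∈ L, Normalizes θ (ν i)) (ha : ∀ i ∈ L, Normalizes θ (a i)) {u : R}
    (hu : Normalizes θ u) :
    θ * u * (L.map fun i => ν i + a i * θ).prod = θ * u * (L.map ν).prod := by
  induction L generalizing u with
  | nil => simp
  | cons i L ih =>
    simp only [List.mem_cons, forall_eq_or_imp] at hν ha
    have h1 : θ * u * (a i * θ) = 0 := by
      simpa only [mul_assoc] using (hu.mul ha.1).mul_self_eq_zero h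
    rw [List.map_cons, List.map_cons, List.prod_cons, List.prod_cons, ← mul_assoc, mul_add, h1,
      add_zero, mul_assoc θ u, ih hν.2 ha.2 (hu.mul hν.1)]
    simp only [mul_assoc]

/-- The part of `∏ (ν i + a i * θ)` that is linear in `θ`. -/
def linearPart (θ : R) : List α → R
  | [] => 0
  | i :: L => ν i * linearPart θ L + a i * θ * (L.map ν).prod

theorem linearPart_add (θ θ' : R) (L : List α) :
    linearPart ν a (θ + θ') L = linearPart ν a θ L + linearPart ν a θ' L := by
  induction L with
  | nil => simp [linearPart]
  | cons i L ih =>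
    simp only [linearPart, ih, mul_add, add_mul]
    abel

theorem exists_linearPart_eq (L : List α)
    (hν : ∀ i ∈ L, Normalizes θ (ν i)) (ha : ∀ i ∈ L, Normalizes θ (a i)) :
    ∃ v, linearPart ν a θ L = θ * v := by
  induction L with
  | nil => exact ⟨0, by simp [linearPart]⟩
  | cons i L ih =>
    simp only [List.mem_cons, forall_eq_or_imp] at hν ha
    obtain ⟨v, hv⟩ := ih hν.2 ha.2
    obtain ⟨x, hx⟩ := hν.1
    obtain ⟨y, hy⟩ := ha.1
    exact ⟨x * v + y * (L.map ν).prod, by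
      rw [linearPart, hv, ← mul_assoc, hx, hy, mul_add, mul_assoc, mul_assoc]⟩

/-- Terms with two or more factors `θ` vanish for the same reason as above. -/
theorem prod_add_mul_eq_add_linearPart (h : θ * θ = 0) (L : List α)
    (hν : ∀ i ∈ L, Normalizes θ (ν i)) (ha : ∀ i ∈ L, Normalizes θ (a i)) :
    (L.map fun i => ν i + a i * θ).prod = (L.map ν).prod + linearPart ν a θ L := by
  induction L with
  | nil => simp [linearPart]
  | cons i L ih =>
    simp only [List.mem_cons, forall_eq_or_imp] at hν ha
    obtain ⟨v, hv⟩ := exists_linearPart_eq ν a L hν.2 ha.2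
    have h1 : θ * linearPart ν a θ L = 0 := by rw [hv, ← mul_assoc, h, zero_mul]
    rw [List.map_cons, List.map_cons, List.prod_cons, List.prod_cons, ih hν.2 ha.2, linearPart,
      add_mul, mul_add, mul_add, mul_assoc (a i) θ (linearPart ν a θ L), h1, mul_zero, add_zero]
    abel

end Normalize

/-! ### Row vectors acting on the `q`-exterior algebra -/

section Exterior

variable {K : Type u} [Field K] {A : Type v} [Ring A] [Algebra K A] {ι κ : Type*} [LinearOrder κ]

/-- Left multiplication by `a` on the functions on finite sets of columns. -/
def coeffOp (K : Type u) [Field K] {A : Type v} [Ring A] [Algebra K A] (κ : Type*) :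
    A →ₐ[K] Module.End K (Finset κ → A) := Algebra.lsmul K K (Finset κ → A)

theorem coeffOp_apply (a : A) (F : Finset κ → A) (S : Finset κ) :
    coeffOp K κ a F S = a * F S := rfl

/-- Left multiplication by the `j`-th generator of the `q`-exterior algebra. -/
def wedgeOp (q : K) (A : Type v) [Ring A] [Algebra K A] (j : κ) :
    Module.End K (Finset κ → A) where
  toFun F S := if j ∈ S then (-q) ^ (S.filter (· < j)).card • F (S.erase j) else 0
  map_add' F G := by
    funext S
    by_cases h : j ∈ S <;> simp [h]
  map_smul' a F := by
    funext S
    by_cases h : j ∈ S <;> simp [h, smul_comm _ a]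

variable {q : K}

theorem wedgeOp_apply (j : κ) (F : Finset κ → A) (S : Finset κ) :
    wedgeOp q A j F S = if j ∈ S then (-q) ^ (S.filter (· < j)).card • F (S.erase j) else 0 := rfl

theorem wedgeOp_mul_coeffOp (j : κ) (a : A) :
    wedgeOp q A j * coeffOp K κ a = coeffOp K κ a * wedgeOp q A j := by
  refine LinearMap.ext fun F => funext fun S => ?_
  simp only [Module.End.mul_apply, wedgeOp_apply, coeffOp_apply]
  split_ifs <;> simp

theorem wedgeOp_mul_self (j : κ) : wedgeOp q A j * wedgeOp q A j = 0 := by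
  refine LinearMap.ext fun F => funext fun S => ?_
  simp [Module.End.mul_apply, wedgeOp_apply]

theorem wedgeOp_mul_wedgeOp {j k : κ} (hjk : j < k) :
    wedgeOp q A k * wedgeOp q A j = (-q) • (wedgeOp q A j * wedgeOp q A k) := by
  refine LinearMap.ext fun F => funext fun S => ?_
  simp only [Module.End.mul_apply, LinearMap.smul_apply, Pi.smul_apply, wedgeOp_apply,
    Finset.mem_erase, ne_eq, hjk.ne, hjk.ne', not_false_eq_true, true_and]
  by_cases hj : j ∈ S <;> by_cases hk : k ∈ S <;> simp only [hj, hk, if_true, if_false, smul_zero]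
  have h1 : (S.erase k).filter (· < j) = S.filter (· < j) := by
    rw [Finset.filter_erase, Finset.erase_eq_of_notMem]
    simp [hjk.not_gt]
  -- Removing the smaller index `j` first lowers the count below `k` by one, while the count below
  -- `j` ignores `k`; hence the factor `-q`.
  have h2 : ((S.erase j).filter (· < k)).card + 1 = (S.filter (· < k)).card := by
    rw [Finset.filter_erase, Finset.card_erase_add_one]
    simp [hj, hjk]
  rw [h1, ← h2, Finset.erase_right_comm, smul_smul, smul_smul, smul_smul]
  congr 1
  ring

/-- `∑_{j ∈ J} x_j ξ_j`. -/
def rowOp (q : K) (J : Finset κ) (x : κ → A) : Module.End K (Finset κ → A) :=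
  ∑ j ∈ J, coeffOp K κ (x j) * wedgeOp q A j

theorem coeffOp_wedgeOp_mul (a b : A) (j k : κ) :
    coeffOp K κ a * wedgeOp q A j * (coeffOp K κ b * wedgeOp q A k)
      = coeffOp K κ (a * b) * (wedgeOp q A j * wedgeOp q A k) := by
  rw [map_mul, mul_assoc, ← mul_assoc (wedgeOp q A j), wedgeOp_mul_coeffOp]
  simp only [mul_assoc]

theorem sum_sum_eq_zero_of_antisymm {M : Type*} [AddCommGroup M] (J : Finset κ) (F : κ → κ → M)
    (h0 : ∀ j ∈ J, F j j = 0) (h : ∀ j ∈ J, ∀ k ∈ J, j < k → F j k + F k j = 0) :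
    ∑ j ∈ J, ∑ k ∈ J, F j k = 0 := by
  induction J using Finset.induction_on with
  | empty => simp
  | insert a J ha ih =>
    simp only [Finset.sum_insert ha, Finset.sum_add_distrib]
    rw [h0 a (by simp), ih (fun j hj => h0 j (by simp [hj]))
      (fun j hj k hk => h j (by simp [hj]) k (by simp [hk])), zero_add, add_zero,
      ← Finset.sum_add_distrib]
    refine Finset.sum_eq_zero fun j hj => ?_
    rcases lt_trichotomy a j with h1 | rfl | h1
    · exact h a (by simp) j (by simp [hj]) h1
    · exact absurd hj ha
    · rw [add_comm]
      exact h j (by simp [hj]) a (by simp) h1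

/-- Squares of generators vanish, and for `j < k` the factor `q` between the entries cancels against
the `-q` between the generators. -/
theorem rowOp_mul_self (J : Finset κ) (x : κ → A)
    (hx : ∀ j ∈ J, ∀ k ∈ J, j < k → x j * x k = q • (x k * x j)) :
    rowOp q J x * rowOp q J x = 0 := by
  simp only [rowOp, Finset.sum_mul_sum, coeffOp_wedgeOp_mul]
  refine sum_sum_eq_zero_of_antisymm J _ (fun j _ => by rw [wedgeOp_mul_self, mul_zero])
    fun j hj k hk hjk => ?_
  rw [wedgeOp_mul_wedgeOp hjk, hx j hj k hk hjk, map_smul, smul_mul_assoc, mul_smul_comm]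
  module

/-- For `j < k`, reordering the generators produces `q²` times `x k * y j` on the right; the `q -
q⁻¹` term in `hdiag` reduces this coefficient to the required 1. -/
theorem rowOp_mul_rowOp (hq : q ≠ 0) (J : Finset κ) (x y : κ → A)
    (hanti : ∀ j ∈ J, ∀ k ∈ J, j < k → x k * y j = y j * x k)
    (hdiag : ∀ j ∈ J, ∀ k ∈ J, j < k → x j * y k = y k * x j + (q - q⁻¹) • (x k * y j)) :
    rowOp q J y * rowOp q J x = rowOp q J x * ((-q) • rowOp q J y) := by
  rw [← sub_eq_zero, mul_smul_comm]
  simp only [rowOp, Finset.sum_mul_sum, coeffOp_wedgeOp_mul, Finset.smul_sum,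
    ← Finset.sum_sub_distrib]
  refine sum_sum_eq_zero_of_antisymm J _ (fun j _ => by simp [wedgeOp_mul_self])
    fun j hj k hk hjk => ?_
  rw [wedgeOp_mul_wedgeOp hjk, hdiag j hj k hk hjk, hanti j hj k hk hjk, map_add, map_smul]
  simp only [add_mul, smul_mul_assoc, mul_smul_comm]
  match_scalars <;> field_simp <;> ring

/-- `u` does not involve the generator `c`. -/
def Avoids (c : κ) (u : Module.End K (Finset κ → A)) : Prop :=
  ∀ F : Finset κ → A, (∀ S, c ∈ S → F S = 0) → ∀ S, c ∈ S → u F S = 0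

namespace Avoids

variable {c : κ} {u w : Module.End K (Finset κ → A)}

theorem mul (hu : Avoids c u) (hw : Avoids c w) : Avoids c (u * w) :=
  fun F hF => hu _ (hw F hF)

theorem add (hu : Avoids c u) (hw : Avoids c w) : Avoids c (u + w) := fun F hF S hS => by
  rw [LinearMap.add_apply, Pi.add_apply, hu F hF S hS, hw F hF S hS, add_zero]

theorem zero : Avoids c (0 : Module.End K (Finset κ → A)) := fun _ _ _ _ => rfl

theorem one : Avoids c (1 : Module.End K (Finset κ → A)) := fun _ hF => hF

theorem coeffOp (a : A) : Avoids c (coeffOp K κ a) := fun F hF S hS => by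
  rw [coeffOp_apply, hF S hS, mul_zero]

theorem wedgeOp {j : κ} (hj : j ≠ c) : Avoids c (wedgeOp q A j) := fun F hF S hS => by
  rw [wedgeOp_apply, hF _ (Finset.mem_erase.2 ⟨hj.symm, hS⟩), smul_zero, ite_self]

theorem rowOp {J : Finset κ} (hc : c ∉ J) (x : κ → A) : Avoids c (rowOp q J x) :=
  Finset.sum_induction _ _ (fun _ _ => add) zero
    fun j hj => (coeffOp _).mul (wedgeOp (by rintro rfl; exact hc hj))

theorem prod {L : List (Module.End K (Finset κ → A))} (h : ∀ u ∈ L, Avoids c u) :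
    Avoids c L.prod := by
  induction L with
  | nil => exact one
  | cons u L ih =>
    rw [List.prod_cons]
    exact (h u (by simp)).mul (ih fun w hw => h w (by simp [hw]))

theorem linearPart {α : Type*} {ν a : α → Module.End K (Finset κ → A)} (L : List α)
    (hν : ∀ i, Avoids c (ν i)) (ha : ∀ i, Avoids c (a i)) (hu : Avoids c u) :
    Avoids c (linearPart ν a u L) := by
  induction L with
  | nil => exact zero
  | cons i L ih =>
    refine ((hν i).mul ih).add (((ha i).mul hu).mul (prod ?_))
    simp only [List.mem_map]
    rintro _ ⟨j, _, rfl⟩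
    exact hν j

end Avoids

/-- The unit of the exterior algebra. -/
def vacuum (κ : Type*) [DecidableEq κ] (A : Type v) [Ring A] : Finset κ → A := Pi.single ∅ 1

theorem vacuum_of_mem {c : κ} {S : Finset κ} (h : c ∈ S) : vacuum κ A S = 0 := by
  rw [vacuum, Pi.single_eq_of_ne]
  rintro rfl
  simp at h

/-- The `q`-minor with rows `L` (in this order) and columns `J`. -/
def listMinor (q : K) (X : ι → κ → A) (L : List ι) (J : Finset κ) : A :=
  (L.map fun i => rowOp q J (X i)).prod (vacuum κ A) J

theorem listMinor_nil (X : ι → κ → A) : listMinor q X [] ∅ = 1 := by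
  simp [listMinor, vacuum]

theorem listMinor_congr {X Y : ι → κ → A} {L : List ι} {J : Finset κ}
    (h : ∀ i ∈ L, ∀ j ∈ J, X i j = Y i j) : listMinor q X L J = listMinor q Y L J := by
  have : (L.map fun i => rowOp q J (X i)) = L.map fun i => rowOp q J (Y i) :=
    List.map_congr_left fun i hi => Finset.sum_congr rfl fun j hj => by rw [h i hi j hj]
  rw [listMinor, listMinor, this]

end Exterior

/-! ### The effect of one pivot step on a minor -/

section Steps

variable {K : Type u} [Field K] {A : Type v} [Ring A] [Algebra K A]
  {ι κ : Type*} [LinearOrder ι] [LinearOrder κ] {q : K}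
  {S : Set (ι × κ)} {X : ι → κ → A} {r : ι} {c : κ} {p : Aˣ}

namespace PartFine

theorem rowOp_mul_self (h : PartFine q S X) (J : Finset κ) (i : ι) :
    rowOp q J (X i) * rowOp q J (X i) = 0 :=
  QuantumMinors.rowOp_mul_self J _ fun _ _ _ _ hjk => h.row i hjk

theorem rowOp_mul_rowOp (h : PartFine q S X) (hS : IsCorner S r c) (hq : q ≠ 0) {J : Finset κ}
    (hJ : ∀ j ∈ J, c < j) {l : ι} (hl : r < l) :
    rowOp q J (X l) * rowOp q J (X r) = rowOp q J (X r) * ((-q) • rowOp q J (X l)) :=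
  QuantumMinors.rowOp_mul_rowOp hq J _ _ (fun _ _ _ _ hjk => h.anti hl hjk)
    fun j hj _ _ hjk => h.diag hl hjk (hS.mem_right le_rfl (hJ j hj))

/-- The coefficient `X i c * p⁻¹` of the row operation in a pivot step. -/
theorem coeff_swap (h : PartFine q S X) (hq : q ≠ 0) (hp : X r c = p) {i : ι} (hi : r < i)
    {j : κ} (hj : c ≤ j) :
    X i c * ((p⁻¹ : Aˣ) : A) * X r j = q⁻¹ • (X r j * (X i c * ((p⁻¹ : Aˣ) : A))) := by
  rcases hj.eq_or_lt with rfl | hj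
  · rw [hp, Units.inv_mul_cancel_right, ← mul_assoc, ← hp, h.col c hi, smul_mul_assoc, hp,
      Units.mul_inv_cancel_right, smul_smul, inv_mul_cancel₀ hq, one_smul]
  · rw [← mul_assoc (X r j), h.anti hi hj, mul_assoc, mul_assoc, h.row_inv hp hj, mul_smul_comm,
      smul_smul, inv_mul_cancel₀ hq, one_smul]

theorem rowOp_pivot_of_lt (X : ι → κ → A) (p : Aˣ) {J : Finset κ}
    (hJ : ∀ j ∈ J, c < j) {l : ι} (hl : r < l) :
    rowOp q J (pivot r c p X l) = rowOp q J (X l)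
      + coeffOp K κ (X l c * ((p⁻¹ : Aˣ) : A)) * rowOp q J (X r) := by
  rw [rowOp, rowOp, rowOp, Finset.mul_sum, ← Finset.sum_add_distrib]
  refine Finset.sum_congr rfl fun j hj => ?_
  rw [pivot_of_lt p X hl (hJ j hj), map_add, add_mul, ← mul_assoc, ← mul_assoc, map_mul _ (_ * _)]

theorem normalizes_coeff (h : PartFine q S X) (hq : q ≠ 0) (hp : X r c = p) {J : Finset κ}
    (hJ : ∀ j ∈ J, c ≤ j) {l : ι} (hl : r < l) :
    Normalizes (rowOp q J (X r)) (coeffOp K κ (X l c * ((p⁻¹ : Aˣ) : A))) := by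
  refine ⟨q⁻¹ • coeffOp K κ (X l c * ((p⁻¹ : Aˣ) : A)), ?_⟩
  rw [rowOp, Finset.mul_sum, Finset.sum_mul]
  refine Finset.sum_congr rfl fun j hj => ?_
  rw [← mul_assoc, ← map_mul, h.coeff_swap hq hp hl (hJ j hj), map_smul, mul_smul_comm,
    mul_assoc, wedgeOp_mul_coeffOp, smul_mul_assoc, map_mul _ (X r j), mul_assoc]

/-- A pivot step to the left of all columns does not change a minor whose first row is the
pivot row. -/
theorem listMinor_pivot_left (h : PartFine q S X) (hS : IsCorner S r c) (hq : q ≠ 0)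
    (hp : X r c = p) {L : List ι} {J : Finset κ} (hL : ∀ i ∈ L, r < i) (hJ : ∀ j ∈ J, c < j) :
    listMinor q (pivot r c p X) (r :: L) J = listMinor q X (r :: L) J := by
  have h1 : (L.map fun i => rowOp q J (pivot r c p X i)) = L.map fun i => rowOp q J (X i)
      + coeffOp K κ (X i c * ((p⁻¹ : Aˣ) : A)) * rowOp q J (X r) :=
    List.map_congr_left fun i hi => rowOp_pivot_of_lt X p hJ (hL i hi)
  have h2 : rowOp q J (pivot r c p X r) = rowOp q J (X r) :=
    Finset.sum_congr rfl fun j _ => by rw [pivot_of_row_le p X le_rfl]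
  have h3 := mul_prod_add_mul_of_normalizes (fun i => rowOp q J (X i))
    (fun i => coeffOp K κ (X i c * ((p⁻¹ : Aˣ) : A))) (h.rowOp_mul_self J r) L
    (fun i hi => ⟨_, h.rowOp_mul_rowOp hS hq hJ (hL i hi)⟩)
    (fun i hi => h.normalizes_coeff hq hp (fun j hj => (hJ j hj).le) (hL i hi)) Normalizes.one
  simp only [mul_one] at h3
  rw [listMinor, listMinor, List.map_cons, List.map_cons, List.prod_cons, List.prod_cons, h1, h2,
    h3]

/-- Only antidiagonal pairs of entries occur, and these commute, so the scalar comes from the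
generators alone. -/
theorem normalizes_of_lt (h : PartFine q S X) (hq : q ≠ 0) {J : Finset κ} {l : ι} (hl : r < l)
    {j : κ} (hJ : ∀ k ∈ J, j < k) :
    Normalizes (rowOp q J (X r)) (coeffOp K κ (X l j) * wedgeOp q A j) := by
  refine ⟨(-q)⁻¹ • (coeffOp K κ (X l j) * wedgeOp q A j), ?_⟩
  rw [rowOp, Finset.mul_sum, Finset.sum_mul]
  refine Finset.sum_congr rfl fun k hk => ?_
  have hjk := hJ k hk
  rw [mul_smul_comm, coeffOp_wedgeOp_mul, coeffOp_wedgeOp_mul, wedgeOp_mul_wedgeOp hjk,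
    mul_smul_comm, smul_smul, inv_mul_cancel₀ (neg_ne_zero.2 hq), one_smul, h.anti hl hjk]

/-- The commutator at `(r, c)` is still switched off, so again only the generators contribute. -/
theorem rowOp_mul_rowOp_singleton (h : PartFine q S X) (hS : IsCorner S r c)
    {J : Finset κ} (hJ : ∀ j ∈ J, c < j) {l : ι} (hl : r < l) :
    rowOp q J (X l) * rowOp q {c} (X r) = rowOp q {c} (X r) * ((-q) • rowOp q J (X l)) := by
  rw [mul_smul_comm, rowOp, rowOp, Finset.sum_singleton, Finset.mul_sum, Finset.sum_mul,
    Finset.smul_sum]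
  refine Finset.sum_congr rfl fun j hj => ?_
  rw [coeffOp_wedgeOp_mul, coeffOp_wedgeOp_mul, wedgeOp_mul_wedgeOp (hJ j hj), mul_smul_comm,
    h.comm hl (hJ j hj) (hS.not_mem le_rfl le_rfl)]

theorem rowOp_union {J J' : Finset κ} (hJ : Disjoint J J') (x : κ → A) :
    rowOp q (J ∪ J') x = rowOp q J x + rowOp q J' x := Finset.sum_union hJ

theorem rowOp_erase (J : Finset κ) (c : κ) (x : κ → A) :
    rowOp q (J.erase c) x = rowOp q (J.filter (· < c)) x + rowOp q (J.filter (c < ·)) x := by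
  rw [← rowOp_union]
  · congr 1
    ext j
    simp only [Finset.mem_erase, Finset.mem_union, Finset.mem_filter, ← and_or_left, ne_eq,
      ← lt_or_lt_iff_ne]
    tauto
  · rw [Finset.disjoint_left]
    intro j h1 h2
    exact (Finset.mem_filter.1 h1).2.not_gt (Finset.mem_filter.1 h2).2

theorem rowOp_filter_le {J : Finset κ} (hc : c ∈ J) (x : κ → A) :
    rowOp q (J.filter (c ≤ ·)) x = rowOp q {c} x + rowOp q (J.filter (c < ·)) x := by
  rw [← rowOp_union]
  · congr 1
    ext j
    simp only [Finset.mem_union, Finset.mem_filter, Finset.mem_singleton, le_iff_eq_or_lt]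
    constructor
    · rintro ⟨h1, rfl | h2⟩ <;> tauto
    · rintro (rfl | h2) <;> tauto
  · simp

/-- Columns left of `c` form only antidiagonal pairs with the pivot row. For columns right of `c`,
the commutator at `(r, c)` is off and those to its right are on, and both parts of the pivot row
give the same factor `-q`. -/
theorem normalizes_rowOp_erase (h : PartFine q S X) (hS : IsCorner S r c) (hq : q ≠ 0)
    {J : Finset κ} (hc : c ∈ J) {l : ι} (hl : r < l) :
    Normalizes (rowOp q (J.filter (c ≤ ·)) (X r)) (rowOp q (J.erase c) (X l)) := by
  rw [rowOp_erase]
  refine (Normalizes.sum fun j hj => h.normalizes_of_lt hq hl fun k hk => ?_).add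
    ⟨(-q) • rowOp q (J.filter (c < ·)) (X l), ?_⟩
  · exact (Finset.mem_filter.1 hj).2.trans_le (Finset.mem_filter.1 hk).2
  · have hJ : ∀ j ∈ J.filter (c < ·), c < j := fun j hj => (Finset.mem_filter.1 hj).2
    rw [rowOp_filter_le hc, mul_add, add_mul, h.rowOp_mul_rowOp_singleton hS hJ hl,
      h.rowOp_mul_rowOp hS hq hJ hl]

theorem normalizes_rowOp_erase_singleton (h : PartFine q S X) (hS : IsCorner S r c) (hq : q ≠ 0)
    {J : Finset κ} {l : ι} (hl : r < l) :
    Normalizes (rowOp q {c} (X r)) (rowOp q (J.erase c) (X l)) := by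
  rw [rowOp_erase]
  refine (Normalizes.sum fun j hj => h.normalizes_of_lt hq hl fun k hk => ?_).add
    ⟨_, h.rowOp_mul_rowOp_singleton hS (fun j hj => (Finset.mem_filter.1 hj).2) hl⟩
  rw [Finset.mem_singleton.1 hk]
  exact (Finset.mem_filter.1 hj).2

/-- Writing `X l c` as `(X l c * p⁻¹) * p` exhibits the column `c` part of a row as a multiple of
the pivot row restricted to column `c`. -/
theorem rowOp_eq_erase_add (hp : X r c = p) {J : Finset κ} (hc : c ∈ J) (l : ι) :
    rowOp q J (X l) = rowOp q (J.erase c) (X l)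
      + coeffOp K κ (X l c * ((p⁻¹ : Aˣ) : A)) * rowOp q {c} (X r) := by
  rw [rowOp, rowOp, rowOp, Finset.sum_singleton, ← Finset.sum_erase_add _ _ hc, add_right_inj,
    ← mul_assoc, ← map_mul, hp, Units.inv_mul_cancel_right]

/-- The step extends that multiple, with the same coefficient, from column `c` to all columns from
`c` on. -/
theorem rowOp_pivot (hp : X r c = p) {J : Finset κ} (hc : c ∈ J) {l : ι} (hl : r < l) :
    rowOp q J (pivot r c p X l) = rowOp q (J.erase c) (X l)
      + coeffOp K κ (X l c * ((p⁻¹ : Aˣ) : A)) * rowOp q (J.filter (c ≤ ·)) (X r) := by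
  have h1 : rowOp q (J.filter (· < c)) (pivot r c p X l) = rowOp q (J.filter (· < c)) (X l) :=
    Finset.sum_congr rfl fun j hj => by rw [pivot_of_col_le p X (Finset.mem_filter.1 hj).2.le]
  have h2 : rowOp q {c} (pivot r c p X l) = rowOp q {c} (X l) :=
    Finset.sum_congr rfl fun j hj => by
      rw [pivot_of_col_le p X (Finset.mem_singleton.1 hj).le]
  have h3 : rowOp q J (pivot r c p X l)
      = rowOp q (J.erase c) (pivot r c p X l) + rowOp q {c} (pivot r c p X l) := by
    rw [rowOp, rowOp, rowOp, Finset.sum_singleton, Finset.sum_erase_add _ _ hc]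
  have h4 : rowOp q {c} (X l)
      = coeffOp K κ (X l c * ((p⁻¹ : Aˣ) : A)) * rowOp q {c} (X r) := by
    rw [rowOp, rowOp, Finset.sum_singleton, Finset.sum_singleton, ← mul_assoc, ← map_mul, hp,
      Units.inv_mul_cancel_right]
  rw [h3, rowOp_erase, h1, rowOp_pivot_of_lt X p (fun j hj => (Finset.mem_filter.1 hj).2) hl, h2,
    h4, rowOp_erase, rowOp_filter_le hc, mul_add]
  abel

theorem avoids_prod (X : ι → κ → A) (L : List ι) (J : Finset κ) (c : κ) :
    Avoids c (L.map fun i => rowOp q (J.erase c) (X i)).prod := by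
  refine Avoids.prod fun u hu => ?_
  obtain ⟨i, _, rfl⟩ := List.mem_map.1 hu
  exact Avoids.rowOp (Finset.notMem_erase c J) _

/-- The first step of the expansion of a minor whose pivot is in its upper left corner. -/
theorem listMinor_pivot_corner (h : PartFine q S X) (hS : IsCorner S r c) (hq : q ≠ 0)
    (hp : X r c = p) {L : List ι} {J : Finset κ} (hL : ∀ i ∈ L, r < i) (hc : c ∈ J)
    (hJ : ∀ j ∈ J, c ≤ j) :
    listMinor q (pivot r c p X) (r :: L) J = p * listMinor q X L (J.erase c) := by
  have hf : J.filter (c ≤ ·) = J := Finset.filter_true_of_mem hJ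
  have h1 : (L.map fun i => rowOp q J (pivot r c p X i)) = L.map fun i =>
      rowOp q (J.erase c) (X i) + coeffOp K κ (X i c * ((p⁻¹ : Aˣ) : A)) * rowOp q J (X r) :=
    List.map_congr_left fun i hi => by rw [rowOp_pivot hp hc (hL i hi), hf]
  have h2 : rowOp q J (pivot r c p X r) = rowOp q J (X r) :=
    Finset.sum_congr rfl fun j _ => by rw [pivot_of_row_le p X le_rfl]
  have h3 := mul_prod_add_mul_of_normalizes (fun i => rowOp q (J.erase c) (X i))
    (fun i => coeffOp K κ (X i c * ((p⁻¹ : Aˣ) : A))) (h.rowOp_mul_self J r) L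
    (fun i hi => by simpa only [hf] using h.normalizes_rowOp_erase hS hq hc (hL i hi))
    (fun i hi => h.normalizes_coeff hq hp hJ (hL i hi)) Normalizes.one
  simp only [mul_one] at h3
  have h4 : rowOp q J (X r)
      = coeffOp K κ (p : A) * wedgeOp q A c + rowOp q (J.erase c) (X r) := by
    rw [rowOp, rowOp, ← Finset.add_sum_erase _ _ hc, hp]
  -- The remaining factors avoid `c`, so the generator `c` must come from the pivot row. It carries
  -- no power of `-q` because `c` is the least column.
  have h5 := avoids_prod (q := q) X L J c (vacuum κ A) fun S hS => vacuum_of_mem hS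
  have h6 : (J.filter (· < c)).card = 0 := by
    rw [Finset.card_eq_zero, Finset.filter_eq_empty_iff]
    exact fun j hj => (hJ j hj).not_gt
  rw [listMinor, listMinor, List.map_cons, List.prod_cons, h1, h2, h3, h4, add_mul,
    LinearMap.add_apply, Pi.add_apply, Module.End.mul_apply (rowOp q _ _),
    Avoids.rowOp (Finset.notMem_erase c J) _ _ h5 J hc, add_zero, Module.End.mul_apply,
    Module.End.mul_apply, coeffOp_apply, wedgeOp_apply, if_pos hc, h6, pow_zero, one_smul]

/-- A pivot step above all rows and in one of the columns does not change a minor. -/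
theorem listMinor_pivot_above (h : PartFine q S X) (hS : IsCorner S r c) (hq : q ≠ 0)
    (hp : X r c = p) {L : List ι} {J : Finset κ} (hL : ∀ i ∈ L, r < i) (hc : c ∈ J) :
    listMinor q (pivot r c p X) L J = listMinor q X L J := by
  have h1 : (L.map fun i => rowOp q J (pivot r c p X i)) = L.map fun i =>
      rowOp q (J.erase c) (X i)
        + coeffOp K κ (X i c * ((p⁻¹ : Aˣ) : A)) * rowOp q (J.filter (c ≤ ·)) (X r) :=
    List.map_congr_left fun i hi => rowOp_pivot hp hc (hL i hi)
  have h2 : (L.map fun i => rowOp q J (X i)) = L.map fun i =>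
      rowOp q (J.erase c) (X i)
        + coeffOp K κ (X i c * ((p⁻¹ : Aˣ) : A)) * rowOp q {c} (X r) :=
    List.map_congr_left fun i _ => rowOp_eq_erase_add hp hc i
  -- Both products are a common part free of `θ` plus a part linear in `θ`, where `θ` is the pivot
  -- row on columns `≥ c` or on `c` alone. The difference is the linear part for columns `> c`; it
  -- avoids `c`, so its coefficient at `J` vanishes.
  rw [listMinor, listMinor, h1, h2,
    prod_add_mul_eq_add_linearPart _ _ (h.rowOp_mul_self _ r) L
      (fun i hi => h.normalizes_rowOp_erase hS hq hc (hL i hi))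
      (fun i hi => h.normalizes_coeff hq hp (fun j hj => (Finset.mem_filter.1 hj).2) (hL i hi)),
    prod_add_mul_eq_add_linearPart _ _ (h.rowOp_mul_self _ r) L
      (fun i hi => h.normalizes_rowOp_erase_singleton hS hq (hL i hi))
      (fun i hi => h.normalizes_coeff hq hp (fun j hj => (Finset.mem_singleton.1 hj).ge)
        (hL i hi)),
    rowOp_filter_le hc, linearPart_add]
  have h3 : Avoids c (linearPart (fun i => rowOp q (J.erase c) (X i))
      (fun i => coeffOp K κ (X i c * ((p⁻¹ : Aˣ) : A))) (rowOp q (J.filter (c < ·)) (X r)) L) :=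
    Avoids.linearPart L (fun i => Avoids.rowOp (Finset.notMem_erase c J) _)
      (fun i => Avoids.coeffOp _) (Avoids.rowOp (by simp) _)
  rw [← add_assoc, LinearMap.add_apply, Pi.add_apply,
    h3 _ (fun S hS => vacuum_of_mem hS) J hc, add_zero]

end PartFine
end Steps

/-! ### Pivoting through the whole matrix of weights -/

section Stages

variable {K : Type u} [Field K] {A : Type v} [Ring A] [Algebra K A] {m n : ℕ}
  {q : K} (w : Fin m → Fin n → Aˣ)

/-- Pivot steps at the last `k` positions of row `r`, from right to left. -/
def sweep (r : Fin m) (X : Fin m → Fin n → A) : ℕ → Fin m → Fin n → A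
  | 0 => X
  | k + 1 => if h : k < n then
      pivot r (Fin.rev ⟨k, h⟩) (w r (Fin.rev ⟨k, h⟩)) (sweep r X k) else sweep r X k

/-- Pivot steps at all positions of the last `k` rows, from bottom to top. -/
def stage : ℕ → Fin m → Fin n → A
  | 0 => fun i j => w i j
  | k + 1 => if h : k < m then sweep w (Fin.rev ⟨k, h⟩) (stage k) n else stage k

variable {w}

theorem sweep_of_le {r i : Fin m} (hi : i ≤ r) (X : Fin m → Fin n → A) (k : ℕ) (j : Fin n) :
    sweep w r X k i j = X i j := by
  induction k with
  | zero => rfl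
  | succ k ih =>
    rw [sweep]
    split_ifs
    · rw [pivot_of_row_le _ _ hi, ih]
    · exact ih

theorem sweep_of_add_le {r i : Fin m} (X : Fin m → Fin n → A) (k : ℕ) (j : Fin n)
    (hj : (j : ℕ) + k ≤ n) : sweep w r X k i j = X i j := by
  induction k with
  | zero => rfl
  | succ k ih =>
    rw [sweep]
    split_ifs with h
    · rw [pivot_of_col_le _ _ (by simp only [Fin.le_def, Fin.val_rev]; omega), ih (by omega)]
    · exact ih (by omega)

/-- Steps in one row do not interact: they run from right to left and change only columns to the
right of the pivot, so column `b` is still original when it is used. -/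
theorem sweep_of_lt {r i : Fin m} (hi : r < i) {X : Fin m → Fin n → A}
    (hX : ∀ j, X r j = w r j) (k : ℕ) (hk : k ≤ n) (j : Fin n) :
    sweep w r X k i j
      = X i j + ∑ b with n ≤ b.1 + k ∧ b < j, X i b * (((w r b)⁻¹ : Aˣ) * (w r j : A)) := by
  induction k with
  | zero =>
    rw [Finset.filter_false_of_mem (fun b _ => by omega)]
    simp [sweep]
  | succ k ih =>
    have h : k < n := hk
    set c : Fin n := Fin.rev ⟨k, h⟩ with hc
    have hcv : (c : ℕ) = n - (k + 1) := by rw [hc, Fin.val_rev]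
    rw [sweep, dif_pos h, ← hc]
    by_cases hj : c < j
    · rw [pivot_of_lt _ _ hi hj, ih h.le, sweep_of_add_le X k c (by omega), sweep_of_le le_rfl, hX,
        add_assoc]
      congr 1
      have h1 : Finset.univ.filter (fun b : Fin n => n ≤ b.1 + (k + 1) ∧ b < j)
          = insert c (Finset.univ.filter fun b : Fin n => n ≤ b.1 + k ∧ b < j) := by
        ext b
        simp only [Finset.mem_filter, Finset.mem_univ, true_and, Finset.mem_insert, Fin.ext_iff,
          Fin.lt_def] at hj ⊢
        omega
      rw [h1, Finset.sum_insert (by simp; omega), add_comm]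
    · rw [pivot_of_col_le _ _ (not_lt.1 hj), ih h.le]
      congr 2
      ext b
      simp only [Finset.mem_filter, Finset.mem_univ, true_and, Fin.lt_def] at hj ⊢
      omega

/-- Only rows strictly below a pivot row change, so each row still consists of invertible weights
when its turn as pivot row comes. -/
theorem stage_eq_weight {k : ℕ} {i : Fin m} (hi : (i : ℕ) + k ≤ m) (j : Fin n) :
    stage w k i j = w i j := by
  induction k with
  | zero => rfl
  | succ k ih =>
    rw [stage, dif_pos (by omega), sweep_of_le (by simp only [Fin.le_def, Fin.val_rev]; omega),
      ih (by omega)]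

/-- The unchanged entry is the term `b = j`. In terms of paths, `b` is the column where the new row
is entered and `j` the column where it is left. -/
theorem stage_succ_of_lt {k : ℕ} (hk : k < m) {i : Fin m} (hi : Fin.rev ⟨k, hk⟩ < i)
    (j : Fin n) :
    stage w (k + 1) i j = ∑ b with b ≤ j, stage w k i b *
      (((w (Fin.rev ⟨k, hk⟩) b)⁻¹ : Aˣ) * (w (Fin.rev ⟨k, hk⟩) j : A)) := by
  rw [stage, dif_pos hk, sweep_of_lt hi
    (fun j => stage_eq_weight (by rw [Fin.val_rev]; dsimp only; omega) j) n le_rfl]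
  have h1 : Finset.univ.filter (fun b : Fin n => b ≤ j)
      = insert j (Finset.univ.filter fun b : Fin n => n ≤ b.1 + n ∧ b < j) := by
    ext b
    simp only [Finset.mem_filter, Finset.mem_univ, true_and, Finset.mem_insert, Fin.ext_iff,
      Fin.lt_def, Fin.le_def]
    omega
  rw [h1, Finset.sum_insert (by simp), Units.inv_mul, mul_one]

/-- The positions used by the first `k` pivot steps in row `r`, together with all lower rows. -/
def sweptSet (r : Fin m) (n k : ℕ) : Set (Fin m × Fin n) :=
  {x | r < x.1 ∨ x.1 = r ∧ n ≤ (x.2 : ℕ) + k}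

theorem isCorner_sweptSet (r : Fin m) {k : ℕ} (h : k < n) :
    IsCorner (sweptSet r n k) r (Fin.rev ⟨k, h⟩) where
  not_mem {i j} hi hj := by
    simp only [sweptSet, Set.mem_ofPred_eq, Fin.le_def, Fin.val_rev, Fin.lt_def, Fin.ext_iff]
      at hi hj ⊢
    omega
  mem_right {i j} hi hj := by
    simp only [sweptSet, Set.mem_ofPred_eq, Fin.le_def, Fin.val_rev, Fin.lt_def, Fin.ext_iff]
      at hi hj ⊢
    omega
  mem_below hi _ := Or.inl hi

theorem insert_sweptSet (r : Fin m) {k : ℕ} (h : k < n) :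
    insert (r, Fin.rev ⟨k, h⟩) (sweptSet r n k) = sweptSet r n (k + 1) := by
  ext ⟨i, j⟩
  simp only [sweptSet, Set.mem_ofPred_eq, Set.mem_insert_iff, Prod.mk.injEq, Fin.ext_iff,
    Fin.val_rev, Fin.lt_def]
  omega

theorem sweep_partFine (hq : q ≠ 0) {r : Fin m} {X : Fin m → Fin n → A}
    (hX : ∀ j, X r j = w r j) (h : PartFine q (sweptSet r n 0) X) {k : ℕ} (hk : k ≤ n) :
    PartFine q (sweptSet r n k) (sweep w r X k) := by
  induction k with
  | zero => exact h
  | succ k ih =>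
    rw [sweep, dif_pos (Nat.lt_of_succ_le hk), ← insert_sweptSet r hk]
    exact (ih (by omega)).pivot (isCorner_sweptSet r hk) hq (by rw [sweep_of_le le_rfl, hX])

theorem sweptSet_zero {k : ℕ} (h : k < m) :
    sweptSet (Fin.rev ⟨k, h⟩) n 0 = {x : Fin m × Fin n | m ≤ x.1.1 + k} := by
  ext ⟨i, j⟩
  simp only [sweptSet, Set.mem_ofPred_eq, Fin.ext_iff, Fin.val_rev, Fin.lt_def]
  omega

theorem sweptSet_last {k : ℕ} (h : k < m) :
    sweptSet (Fin.rev ⟨k, h⟩) n n = {x : Fin m × Fin n | m ≤ x.1.1 + (k + 1)} := by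
  ext ⟨i, j⟩
  simp only [sweptSet, Set.mem_ofPred_eq, Fin.ext_iff, Fin.val_rev, Fin.lt_def]
  omega


theorem stage_partFine (hw : PartFine q ∅ fun i j => (w i j : A)) (hq : q ≠ 0) {k : ℕ} (hk : k ≤ m) :

    PartFine q {x : Fin m × Fin n | m ≤ x.1.1 + k} (stage w k) := by
  induction k with
  | zero =>
    have : {x : Fin m × Fin n | m ≤ x.1.1 + 0} = ∅ := by
      ext ⟨i, j⟩
      simp
    rw [this]
    exact hw
  | succ k ih =>
    rw [stage, dif_pos (Nat.lt_of_succ_le hk), ← sweptSet_last hk]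
    refine sweep_partFine hq (stage_eq_weight ?_) (by rw [sweptSet_zero]; exact ih (by omega))
      le_rfl
    rw [Fin.val_rev]
    dsimp only
    omega

theorem sweep_stage_partFine (hw : PartFine q ∅ fun i j => (w i j : A)) (hq : q ≠ 0) {k s : ℕ}
    (hk : k < m) (hs : s ≤ n) :
    PartFine q (sweptSet (Fin.rev ⟨k, hk⟩) n s) (sweep w (Fin.rev ⟨k, hk⟩) (stage w k) s) := by
  refine sweep_partFine hq (stage_eq_weight ?_)
    (by rw [sweptSet_zero]; exact stage_partFine hw hq hk.le) hs
  rw [Fin.val_rev]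
  dsimp only
  omega

theorem sweep_stage_pivot {k s : ℕ} (hk : k < m) (j : Fin n) :
    sweep w (Fin.rev ⟨k, hk⟩) (stage w k) s (Fin.rev ⟨k, hk⟩) j = w (Fin.rev ⟨k, hk⟩) j := by
  rw [sweep_of_le le_rfl, stage_eq_weight]
  rw [Fin.val_rev]
  dsimp only
  omega

/-- A pivot column in `J` is harmless by `listMinor_pivot_above`; one not to the left of any column
of `J` leaves the entries in `J` untouched. -/
theorem listMinor_sweep_above (hw : PartFine q ∅ fun i j => (w i j : A)) (hq : q ≠ 0) {k s : ℕ}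
    (hk : k < m) (hs : s ≤ n) {L : List (Fin m)}
    {J : Finset (Fin n)} (hL : ∀ i ∈ L, Fin.rev ⟨k, hk⟩ < i)
    (hJ : ∀ c : Fin n, n ≤ c.1 + s → c ∈ J ∨ ∀ j ∈ J, j ≤ c) :
    listMinor q (sweep w (Fin.rev ⟨k, hk⟩) (stage w k) s) L J = listMinor q (stage w k) L J := by
  induction s with
  | zero => rfl
  | succ s ih =>
    rw [sweep, dif_pos (Nat.lt_of_succ_le hs), ← ih (by omega) fun c hc => hJ c (by omega)]
    rcases hJ (Fin.rev ⟨s, hs⟩) (by rw [Fin.val_rev]; dsimp only; omega) with h | h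
    · exact (sweep_stage_partFine hw hq hk (by omega)).listMinor_pivot_above
        (isCorner_sweptSet _ hs) hq (sweep_stage_pivot hk _) hL h
    · exact listMinor_congr fun i _ j hj => pivot_of_col_le _ _ (h j hj)

theorem listMinor_sweep_left (hw : PartFine q ∅ fun i j => (w i j : A)) (hq : q ≠ 0) {k s t : ℕ}
    (hk : k < m) (hs : s ≤ n)
    {L : List (Fin m)} {J : Finset (Fin n)} (hL : ∀ i ∈ L, Fin.rev ⟨k, hk⟩ < i)
    (hJ : ∀ j ∈ J, n ≤ j.1 + t) (hts : t ≤ s) :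
    listMinor q (sweep w (Fin.rev ⟨k, hk⟩) (stage w k) s) (Fin.rev ⟨k, hk⟩ :: L) J
      = listMinor q (sweep w (Fin.rev ⟨k, hk⟩) (stage w k) t) (Fin.rev ⟨k, hk⟩ :: L) J := by
  induction s, hts using Nat.le_induction with
  | base => rfl
  | succ s hts ih =>
    rw [sweep, dif_pos (Nat.lt_of_succ_le hs), ← ih (by omega)]
    refine (sweep_stage_partFine hw hq hk (by omega)).listMinor_pivot_left
      (isCorner_sweptSet _ hs) hq (sweep_stage_pivot hk _) hL fun j hj => ?_
    have := hJ j hj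
    simp only [Fin.lt_def, Fin.val_rev]
    omega

/-- The rows `r, …, r + k - 1`. -/
def rowList (r k : ℕ) (h : r + k ≤ m) : List (Fin m) :=
  List.ofFn fun d : Fin k => ⟨r + d, by omega⟩

/-- The columns `c, …, c + k - 1`. -/
def colSet (n c k : ℕ) : Finset (Fin n) := Finset.univ.filter fun j => c ≤ j.1 ∧ j.1 < c + k

theorem mem_colSet {c k : ℕ} {j : Fin n} : j ∈ colSet n c k ↔ c ≤ j.1 ∧ j.1 < c + k := by
  simp [colSet]

theorem rowList_succ {r k : ℕ} (h : r + (k + 1) ≤ m) :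
    rowList r (k + 1) h = ⟨r, by omega⟩ :: rowList (r + 1) k (by omega) := by
  rw [rowList, List.ofFn_succ, rowList]
  congr 2
  funext d
  simp only [Fin.val_succ, Fin.mk.injEq]
  omega

theorem le_of_mem_rowList {r k : ℕ} {h : r + k ≤ m} {i : Fin m} (hi : i ∈ rowList r k h) :
    r ≤ i := by
  obtain ⟨d, rfl⟩ := (List.mem_ofFn' _ _).1 hi
  exact Nat.le_add_right r d

theorem erase_colSet {c k : ℕ} (hc : c < n) :
    (colSet n c (k + 1)).erase ⟨c, hc⟩ = colSet n (c + 1) k := by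
  ext j
  simp only [Finset.mem_erase, mem_colSet, ne_eq, Fin.ext_iff]
  omega

/-- An interval minor with top row `r`, after the pivot steps in the rows from `r` on, is the
product of the weights on its diagonal. -/
theorem listMinor_stage (hw : PartFine q ∅ fun i j => (w i j : A)) (hq : q ≠ 0) (k : ℕ) {r c t : ℕ}
    (hr : r + k ≤ m) (hc : c + k ≤ n)
    (ht : r + t = m) :
    listMinor q (stage w t) (rowList r k hr) (colSet n c k)
      = (List.ofFn fun d : Fin k =>
          (w ⟨r + d, by omega⟩ ⟨c + d, by omega⟩ : A)).prod := by
  induction k generalizing r c t with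
  | zero =>
    have : colSet n c 0 = ∅ := by
      ext j
      simp only [mem_colSet, Finset.notMem_empty, iff_false]
      omega
    rw [this]
    simp [rowList, listMinor_nil]
  | succ k ih =>
    obtain ⟨t, rfl⟩ : ∃ t', t = t' + 1 := ⟨t - 1, by omega⟩
    have htm : t < m := by omega
    have hrow : (⟨r, by omega⟩ : Fin m) = Fin.rev ⟨t, htm⟩ := by
      simp only [Fin.ext_iff, Fin.val_rev]
      omega
    have hs : n - (c + 1) < n := by omega
    have hcol : (⟨c, by omega⟩ : Fin n) = Fin.rev ⟨n - (c + 1), hs⟩ := by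
      simp only [Fin.ext_iff, Fin.val_rev]
      omega
    have hL : ∀ i ∈ rowList (r + 1) k (by omega : r + 1 + k ≤ m), Fin.rev ⟨t, htm⟩ < i := by
      intro i hi
      rw [← hrow, Fin.lt_def]
      exact le_of_mem_rowList hi
    -- Of the pivots in row `r`, those left of column `c` have no effect, the one at `c` splits off
    -- its weight, and those right of `c` do not affect the remaining minor, which starts at `(r +
    -- 1, c + 1)`.
    rw [rowList_succ, stage, dif_pos htm, hrow,
      listMinor_sweep_left hw hq htm le_rfl hL (t := n - (c + 1) + 1)
        (fun j hj => by have := (mem_colSet.1 hj).1; omega) (by omega),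
      sweep, dif_pos hs,
      (sweep_stage_partFine hw hq htm hs.le).listMinor_pivot_corner (isCorner_sweptSet _ hs) hq
        (sweep_stage_pivot htm _) hL
        (by rw [← hcol, mem_colSet]; dsimp only; omega)
        (fun j hj => by rw [← hcol, Fin.le_def]; exact (mem_colSet.1 hj).1),
      ← hcol, erase_colSet,
      listMinor_sweep_above hw hq htm hs.le hL
        (fun b hb => by
          by_cases hbk : b.1 < c + 1 + k
          · exact Or.inl (mem_colSet.2 ⟨by omega, hbk⟩)
          · exact Or.inr fun j hj => by
              have := (mem_colSet.1 hj).2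
              rw [Fin.le_def]
              omega),
      ih (by omega) (by omega) (by omega), List.ofFn_succ, List.prod_cons, ← hrow]
    congr 2
    · congr 1
      funext d
      congr 3 <;> simp only [Fin.val_succ] <;> omega

/-- For an initial interval of columns every pivot column lies in it or to its right, so no pivot in
a higher row changes the minor. -/
theorem listMinor_stage_add (hw : PartFine q ∅ fun i j => (w i j : A)) (hq : q ≠ 0) {k r t s : ℕ}
    (hr : r + k ≤ m)
    (ht : r + t = m) (hs : t + s ≤ m) :
    listMinor q (stage w (t + s)) (rowList r k hr) (colSet n 0 k)
      = listMinor q (stage w t) (rowList r k hr) (colSet n 0 k) := by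
  induction s with
  | zero => rfl
  | succ s ih =>
    rw [← ih (by omega), ← add_assoc, stage, dif_pos (by omega : t + s < m)]
    refine listMinor_sweep_above hw hq _ le_rfl (fun i hi => ?_) fun b _ => ?_
    · have := le_of_mem_rowList hi
      simp only [Fin.lt_def, Fin.val_rev]
      omega
    · by_cases hbk : b.1 < 0 + k
      · exact Or.inl (mem_colSet.2 ⟨by omega, hbk⟩)
      · exact Or.inr fun j hj => by
          have := (mem_colSet.1 hj).2
          rw [Fin.le_def]
          omega

/-- The interval minors of the last stage with top row or leftmost column `0`. -/
theorem listMinor_stage_last (hw : PartFine q ∅ fun i j => (w i j : A)) (hq : q ≠ 0) {k r c : ℕ}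
    (hr : r + k ≤ m) (hc : c + k ≤ n)
    (hrc : r = 0 ∨ c = 0) :
    listMinor q (stage w m) (rowList r k hr) (colSet n c k)
      = (List.ofFn fun d : Fin k =>
          (w ⟨r + d, by omega⟩ ⟨c + d, by omega⟩ : A)).prod := by
  rcases hrc with rfl | rfl
  · exact listMinor_stage hw hq k hr hc (by omega)
  · rw [← listMinor_stage hw hq k hr hc (by omega : r + (m - r) = m),
      ← listMinor_stage_add hw hq hr (by omega : r + (m - r) = m) (s := r) (by omega)]
    congr 2
    omega

end Stages

/-! ### Path sums and the path matrix -/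

section Paths

variable {A : Type v} [Ring A] {m n : ℕ}

theorem GridEdge.not_sink {j : Fin n} {y : GridVertex m n} : ¬ GridEdge (.sink j) y := by
  rintro (h | h) <;> cases h

/-- The distance travelled from the lower left corner of the grid. -/
def GridVertex.rank : GridVertex m n → ℕ
  | .source _ => 0
  | .inner i j => (m - i) + j + 1
  | .sink _ => m + n + 2

theorem GridEdge.rank_lt {x y : GridVertex m n} (h : GridEdge x y) : x.rank < y.rank := by
  rcases h with h | h <;> cases h <;> simp only [GridVertex.rank] <;> omega

/-- The rank strictly increases along edges, so the grid is acyclic and distinctness of the vertices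
of a path is automatic. -/
theorem notMem_of_isChain_cons {x : GridVertex m n} {p : List (GridVertex m n)}
    (h : (x :: p).IsChain GridEdge) : x ∉ p := by
  have h1 : (x :: p).IsChain fun a b : GridVertex m n => a.rank < b.rank :=
    h.imp fun _ _ => GridEdge.rank_lt
  have : IsTrans (GridVertex m n) fun a b => a.rank < b.rank := ⟨fun _ _ _ => lt_trans⟩
  have h2 := List.isChain_iff_pairwise.1 h1
  exact fun hx => lt_irrefl _ ((List.pairwise_cons.1 h2).1 x hx)

/-- `p` is a directed path from `x` to the sink `j`. -/
def IsPathTo (x : GridVertex m n) (j : Fin n) (p : List (GridVertex m n)) : Prop :=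
  p.IsChain GridEdge ∧ p.head? = some x ∧ p.getLast? = some (.sink j)

open Classical in
/-- The directed paths from `x` to the sink `j`. -/
noncomputable def pathsTo (x : GridVertex m n) (j : Fin n) :
    Finset {p : List (GridVertex m n) // p.Nodup} :=
  Finset.univ.filter fun p => IsPathTo x j p.1

theorem mem_pathsTo {x : GridVertex m n} {j : Fin n} {p : {p : List (GridVertex m n) // p.Nodup}} :
    p ∈ pathsTo x j ↔ IsPathTo x j p.1 := by
  simp [pathsTo]

/-- The total weight of the directed paths from `x` to the sink `j`. -/
noncomputable def pathSum (w : Fin m → Fin n → Aˣ) (x : GridVertex m n) (j : Fin n) : A :=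
  ∑ p ∈ pathsTo x j, (pathWeight w p.1 : A)

theorem pathMatrix_eq_pathSum (w : Fin m → Fin n → Aˣ) (i : Fin m) (j : Fin n) :
    pathMatrix w i j = pathSum w (.source i) j := by
  rw [pathMatrix, Matrix.of_apply, pathSum]
  refine Finset.sum_congr ?_ fun _ _ => rfl
  ext p
  simp [gridPaths, mem_pathsTo, IsPathTo]

theorem pathSum_sink (w : Fin m → Fin n → Aˣ) (b j : Fin n) :
    pathSum w (.sink b) j = if b = j then 1 else 0 := by
  have h : ∀ p : List (GridVertex m n), IsPathTo (.sink b) j p ↔ p = [.sink b] ∧ b = j := by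
    intro p
    constructor
    · rintro ⟨h1, h2, h3⟩
      match p, h1, h2, h3 with
      | [x], _, h2, h3 =>
        simp only [List.head?_cons, Option.some.injEq] at h2
        subst h2
        simpa using h3
      | x :: y :: p, h1, h2, _ =>
        simp only [List.head?_cons, Option.some.injEq] at h2
        subst h2
        exact absurd (List.isChain_cons_cons.1 h1).1 GridEdge.not_sink
    · rintro ⟨rfl, rfl⟩
      exact ⟨List.isChain_singleton _, rfl, rfl⟩
  split_ifs with hb
  · have : pathsTo (.sink b : GridVertex m n) j = {⟨[.sink b], List.nodup_singleton _⟩} := by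
      ext p
      rw [mem_pathsTo, h, Finset.mem_singleton, Subtype.ext_iff]
      simp [hb]
    rw [pathSum, this, Finset.sum_singleton]
    simp [pathWeight]
  · refine Finset.sum_eq_zero fun p hp => ?_
    rw [mem_pathsTo, h] at hp
    exact absurd hp.2 hb

theorem isPathTo_cons {x : GridVertex m n} {j : Fin n} {p : List (GridVertex m n)}
    (hx : x ≠ .sink j) :
    IsPathTo x j (x :: p) ↔ ∃ y, GridEdge x y ∧ IsPathTo y j p := by
  constructor
  · rintro ⟨h1, _, h3⟩
    match p, h1, h3 with
    | [], _, h3 => exact absurd (by simpa using h3) hx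
    | y :: p, h1, h3 =>
      rw [List.isChain_cons_cons] at h1
      exact ⟨y, h1.1, h1.2, rfl, by simpa using h3⟩
  · rintro ⟨y, hxy, h1, h2, h3⟩
    match p, h1, h2, h3 with
    | z :: p, h1, h2, h3 =>
      simp only [List.head?_cons, Option.some.injEq] at h2
      subst h2
      exact ⟨List.isChain_cons_cons.2 ⟨hxy, h1⟩, rfl, by simpa using h3⟩

open Classical in
theorem pathSum_eq_sum (w : Fin m → Fin n → Aˣ) {x : GridVertex m n} {j : Fin n}
    (hx : x ≠ .sink j) :
    pathSum w x j = ∑ y with GridEdge x y, (edgeWeight w x y : A) * pathSum w y j := by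
  simp only [pathSum, Finset.mul_sum]
  rw [Finset.sum_sigma']
  symm
  refine Finset.sum_bij (fun a ha => ⟨x :: a.2.1, ?_⟩) ?_ ?_ ?_ ?_
  · simp only [Finset.mem_sigma, Finset.mem_filter, Finset.mem_univ, true_and, mem_pathsTo] at ha
    exact List.nodup_cons.2
      ⟨notMem_of_isChain_cons ((isPathTo_cons hx).2 ⟨_, ha.1, ha.2⟩).1, a.2.2⟩
  · intro a ha
    simp only [Finset.mem_sigma, Finset.mem_filter, Finset.mem_univ, true_and, mem_pathsTo] at ha ⊢
    exact (isPathTo_cons hx).2 ⟨_, ha.1, ha.2⟩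
  · rintro ⟨y, p, hp⟩ h1 ⟨y', p', hp'⟩ h2 h
    simp only [Finset.mem_sigma, Finset.mem_filter, Finset.mem_univ, true_and, mem_pathsTo]
      at h1 h2
    simp only [Subtype.mk.injEq, List.cons.injEq, true_and] at h
    subst h
    have := h1.2.2.1.symm.trans h2.2.2.1
    simp only [Option.some.injEq] at this
    subst this
    rfl
  · rintro ⟨p, hp⟩ h
    rw [mem_pathsTo] at h
    match p, hp, h with
    | z :: p, hp, h =>
      have hz : z = x := by simpa using h.2.1
      subst hz
      obtain ⟨y, hy, hyp⟩ := (isPathTo_cons hx).1 h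
      exact ⟨⟨y, p, (List.nodup_cons.1 hp).2⟩, by simp [mem_pathsTo, hy, hyp], rfl⟩
  · rintro ⟨y, p, hp⟩ h
    simp only [Finset.mem_sigma, Finset.mem_filter, Finset.mem_univ, true_and, mem_pathsTo] at h
    obtain ⟨h1, h2, h3, h4⟩ := h
    match p, h3 with
    | z :: p, h3 =>
      have hz : z = y := by simpa using h3
      subst hz
      simp [pathWeight]

/-- The vertex above `(i, b)`. -/
def vertexAbove (i : Fin m) (b : Fin n) : GridVertex m n :=
  if (i : ℕ) = 0 then .sink b else .inner ⟨i - 1, by omega⟩ b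

theorem gridEdge_inner_iff {i : Fin m} {a : Fin n} {y : GridVertex m n} :
    GridEdge (.inner i a) y ↔ y = vertexAbove i a ∨ ∃ h : a.1 + 1 < n, y = .inner i ⟨a + 1, h⟩ := by
  constructor
  · rintro (h | h)
    · cases h with
      | inner _ _ j' h =>
        exact Or.inr ⟨by omega, by congr 1; exact Fin.ext h⟩
    · left
      cases h with
      | toSink _ _ h => rw [vertexAbove, if_pos h]
      | inner _ i' _ h =>
        rw [vertexAbove, if_neg (by omega)]
        congr 1
        exact Fin.ext (by dsimp only; omega)
  · rintro (rfl | ⟨h, rfl⟩)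
    · rw [vertexAbove]
      split_ifs with h
      · exact Or.inr (.toSink _ _ h)
      · exact Or.inr (.inner _ _ _ (by dsimp only; omega))
    · exact Or.inl (.inner _ _ _ rfl)

theorem edgeWeight_vertexAbove (w : Fin m → Fin n → Aˣ) (i : Fin m) (a : Fin n) :
    edgeWeight w (.inner i a) (vertexAbove i a) = 1 := by
  rw [vertexAbove]
  split_ifs with h
  · rfl
  · rw [edgeWeight, if_neg]
    intro h
    generalize (⟨i - 1, by omega⟩ : Fin m) = i' at h
    cases h with
    | inner _ _ _ h => omega

theorem pathSum_inner_of_lt (w : Fin m → Fin n → Aˣ) (i : Fin m) {a : Fin n} (j : Fin n)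
    (ha : a.1 + 1 < n) :
    pathSum w (.inner i a) j = pathSum w (vertexAbove i a) j
      + ((w i a)⁻¹ : Aˣ) * (w i ⟨a + 1, ha⟩ : A) * pathSum w (.inner i ⟨a + 1, ha⟩) j := by
  classical
  rw [pathSum_eq_sum w (by simp)]
  have h1 : (Finset.univ.filter fun y : GridVertex m n => GridEdge (.inner i a) y)
      = {vertexAbove i a, .inner i ⟨a + 1, ha⟩} := by
    ext y
    simp [gridEdge_inner_iff, ha]
  have h2 : vertexAbove i a ≠ .inner i ⟨a + 1, ha⟩ := by
    rw [vertexAbove]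
    split_ifs <;> simp [Fin.ext_iff]
  rw [h1, Finset.sum_pair h2, edgeWeight_vertexAbove, Units.val_one, one_mul, edgeWeight,
    if_pos (.inner _ _ _ rfl), Units.val_mul]

theorem pathSum_inner_of_last (w : Fin m → Fin n → Aˣ) (i : Fin m) {a : Fin n} (j : Fin n)
    (ha : ¬ a.1 + 1 < n) : pathSum w (.inner i a) j = pathSum w (vertexAbove i a) j := by
  classical
  rw [pathSum_eq_sum w (by simp)]
  have h1 : (Finset.univ.filter fun y : GridVertex m n => GridEdge (.inner i a) y)
      = {vertexAbove i a} := by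
    ext y
    simp [gridEdge_inner_iff, ha]
  rw [h1, Finset.sum_singleton, edgeWeight_vertexAbove, Units.val_one, one_mul]

/-- Paths are grouped by the column `b` where they leave row `i`; the weights of the horizontal
edges up to there telescope. -/
theorem pathSum_inner (w : Fin m → Fin n → Aˣ) (i : Fin m) (a j : Fin n) :
    pathSum w (.inner i a) j = ∑ b with a ≤ b,
      ((w i a)⁻¹ : Aˣ) * (w i b : A) * pathSum w (vertexAbove i b) j := by
  obtain ⟨k, hk⟩ : ∃ k, n - a.1 = k := ⟨_, rfl⟩
  induction k generalizing a with
  | zero => omega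
  | succ k ih =>
    by_cases ha : a.1 + 1 < n
    · have h1 : (Finset.univ.filter fun b : Fin n => a ≤ b)
          = insert a (Finset.univ.filter fun b : Fin n => (⟨a + 1, ha⟩ : Fin n) ≤ b) := by
        ext b
        simp only [Finset.mem_filter, Finset.mem_univ, true_and, Finset.mem_insert, Fin.le_def,
          Fin.ext_iff]
        omega
      rw [pathSum_inner_of_lt w i j ha, ih ⟨a + 1, ha⟩ (by dsimp only; omega), h1,
        Finset.sum_insert (by simp [Fin.le_def]), Units.inv_mul, one_mul, Finset.mul_sum]
      simp only [mul_assoc, Units.mul_inv_cancel_left]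
    · have h1 : (Finset.univ.filter fun b : Fin n => a ≤ b) = {a} := by
        ext b
        simp only [Finset.mem_filter, Finset.mem_univ, true_and, Finset.mem_singleton, Fin.le_def,
          Fin.ext_iff]
        omega
      rw [pathSum_inner_of_last w i j ha, h1, Finset.sum_singleton, Units.inv_mul, one_mul]

theorem pathSum_source (w : Fin m → Fin n → Aˣ) (i : Fin m) (j : Fin n) :
    pathSum w (.source i) j = ∑ b, (w i b : A) * pathSum w (vertexAbove i b) j := by
  classical
  have hn : 0 < n := j.pos
  have h1 : (Finset.univ.filter fun y : GridVertex m n => GridEdge (.source i) y)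
      = {.inner i ⟨0, hn⟩} := by
    ext y
    simp only [Finset.mem_filter, Finset.mem_univ, true_and, Finset.mem_singleton]
    constructor
    · rintro (h | h)
      · cases h with
        | fromSource _ j h =>
          congr 1
          exact Fin.ext h
      · cases h
    · rintro rfl
      exact Or.inl (.fromSource _ _ rfl)
  have h2 : (Finset.univ.filter fun b : Fin n => (⟨0, hn⟩ : Fin n) ≤ b) = Finset.univ :=
    Finset.filter_true_of_mem fun b _ => by simp [Fin.le_def]
  rw [pathSum_eq_sum w (by simp), h1, Finset.sum_singleton, pathSum_inner, h2, Finset.mul_sum]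
  refine Finset.sum_congr rfl fun b _ => ?_
  simp only [edgeWeight, mul_assoc, Units.mul_inv_cancel_left]

/-- Here `stage w k i b` is the total weight of the initial parts of paths from the source of row
`i` that leave row `r` upwards in column `b`. Passing to the next row is `stage_succ_of_lt` combined
with `pathSum_inner`. -/
theorem sum_stage_mul_pathSum (w : Fin m → Fin n → Aˣ) {k : ℕ} {r i : Fin m}
    (hr : r.1 + k = m) (hi : r ≤ i) (j : Fin n) :
    ∑ b, stage w k i b * pathSum w (vertexAbove r b) j = pathSum w (.source i) j := by
  induction k generalizing r with
  | zero => omega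
  | succ k ih =>
    rcases hi.eq_or_lt with rfl | hi
    · rw [pathSum_source]
      exact Finset.sum_congr rfl fun b _ => by rw [stage_eq_weight (by omega)]
    have hk : k < m := by omega
    have hrow : (Fin.rev ⟨k, hk⟩ : Fin m) = r :=
      Fin.ext (by rw [Fin.val_rev]; dsimp only; omega)
    have hr' : r.1 + 1 < m := by omega
    have habove (b : Fin n) : vertexAbove (⟨r + 1, hr'⟩ : Fin m) b = .inner r b := by
      rw [vertexAbove, if_neg (by simp)]
      rfl
    rw [← ih (r := ⟨r + 1, hr'⟩) (by dsimp only; omega) (by rw [Fin.le_def]; exact hi)]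
    simp only [habove, pathSum_inner w r, stage_succ_of_lt hk (hrow ▸ hi), hrow, Finset.sum_mul,
      Finset.mul_sum, Finset.sum_filter]
    rw [Finset.sum_comm]
    refine Finset.sum_congr rfl fun a _ => Finset.sum_congr rfl fun b _ => ?_
    split_ifs <;> simp only [mul_assoc, zero_mul, mul_zero]

theorem stage_last_eq_pathMatrix (w : Fin m → Fin n → Aˣ) (i : Fin m) (j : Fin n) :
    stage w m i j = pathMatrix w i j := by
  have hm : 0 < m := i.pos
  rw [pathMatrix_eq_pathSum, ← sum_stage_mul_pathSum w (k := m) (r := ⟨0, hm⟩) (by simp)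
    (by simp [Fin.le_def])]
  -- Above the top row there are only sinks, so the sum reduces to the term `b = j`.
  simp only [vertexAbove, if_true, pathSum_sink, mul_ite, mul_one, mul_zero]
  simp

end Paths

/-! ### Expansion of operator products over permutations -/

section Expansion

variable {K : Type u} [Field K] {A : Type v} [Ring A] [Algebra K A] {κ : Type*} [LinearOrder κ]
  [Fintype κ] {q : K}

/-- The number of inversions of a sequence. -/
def seqLength {k : ℕ} (g : Fin k → κ) : ℕ :=
  (Finset.univ.filter fun p : Fin k × Fin k => p.1 < p.2 ∧ g p.2 < g p.1).card

/-- The inversions that involve the first entry `j` are counted by the smaller entries after it,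
which is the exponent in `wedgeOp`. -/
theorem seqLength_cons {k : ℕ} (j : κ) (g : Fin k → κ) (hg : Function.Injective g) :
    seqLength (Fin.cons j g : Fin (k + 1) → κ)
      = ((Finset.univ.image g).filter (· < j)).card + seqLength g := by
  rw [Finset.filter_image, Finset.card_image_of_injective _ hg]
  simp only [seqLength, Finset.card_filter, Fintype.sum_prod_type, Fin.sum_univ_succ,
    Fin.cons_zero, Fin.cons_succ, Fin.succ_lt_succ_iff, Fin.succ_pos, Fin.not_lt_zero, false_and,
    true_and, if_false, zero_add]

theorem cons_injective_and_image_iff {k : ℕ} (j : κ) (g : Fin k → κ) (S : Finset κ) :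
    (Function.Injective (Fin.cons j g : Fin (k + 1) → κ) ∧
        Finset.univ.image (Fin.cons j g : Fin (k + 1) → κ) = S) ↔
      j ∈ S ∧ Function.Injective g ∧ Finset.univ.image g = S.erase j := by
  have h1 : Finset.univ.image (Fin.cons j g : Fin (k + 1) → κ)
      = insert j (Finset.univ.image g) := by
    ext x
    simp [Fin.exists_fin_succ, eq_comm]
  have h2 : j ∈ Set.range g ↔ j ∈ Finset.univ.image g := by simp
  rw [h1, Fin.cons_injective_iff, h2]
  constructor
  · rintro ⟨⟨h3, h4⟩, rfl⟩
    exact ⟨Finset.mem_insert_self _ _, h4, (Finset.erase_insert h3).symm⟩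
  · rintro ⟨h3, h4, h5⟩
    rw [h5]
    exact ⟨⟨Finset.notMem_erase j S, h4⟩, Finset.insert_erase h3⟩

theorem prod_rowOp_vacuum {k : ℕ} (x : Fin k → κ → A) (J S : Finset κ) (hS : S ⊆ J) :
    (List.ofFn fun d => rowOp q J (x d)).prod (vacuum κ A) S
      = ∑ g : Fin k → κ with Function.Injective g ∧ Finset.univ.image g = S,
          (-q) ^ seqLength g • (List.ofFn fun d => x d (g d)).prod := by
  induction k generalizing S with
  | zero =>
    have h1 (g : Fin 0 → κ) : Function.Injective g := Function.injective_of_subsingleton g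
    by_cases h : S = ∅
    · simp [h, h1, vacuum, seqLength]
    · simp [h1, vacuum, Ne.symm h, h]
  | succ k ih =>
    have hcons (j : κ) (g : Fin k → κ) :
        (Fin.consEquiv fun _ => κ) (j, g) = (Fin.cons j g : Fin (k + 1) → κ) := rfl
    rw [List.ofFn_succ, List.prod_cons, Module.End.mul_apply, rowOp, LinearMap.sum_apply,
      Finset.sum_apply, Finset.sum_filter, ← (Fin.consEquiv fun _ => κ).sum_comp,
      Fintype.sum_prod_type, ← Finset.sum_subset (Finset.subset_univ J)]
    · refine Finset.sum_congr rfl fun j _ => ?_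
      simp only [Module.End.mul_apply, coeffOp_apply, wedgeOp_apply, hcons,
        cons_injective_and_image_iff]
      split_ifs with hj
      · rw [ih _ _ ((Finset.erase_subset _ _).trans hS), Finset.sum_filter, Finset.smul_sum,
          Finset.mul_sum]
        refine Finset.sum_congr rfl fun g _ => ?_
        simp only [hj, true_and]
        split_ifs with hg
        · have h1 : (S.erase j).filter (· < j) = S.filter (· < j) := by
            rw [Finset.filter_erase, Finset.erase_eq_of_notMem]
            simp
          rw [seqLength_cons j g hg.1, hg.2, h1, List.ofFn_succ, List.prod_cons, Fin.cons_zero,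
            pow_add, mul_smul, mul_smul_comm, mul_smul_comm]
          simp only [Fin.cons_succ]
        · rw [smul_zero, mul_zero]
      · simp [hj]
    · intro j _ hj
      refine Finset.sum_eq_zero fun g _ => if_neg ?_
      rw [hcons, cons_injective_and_image_iff]
      exact fun h => hj (hS h.1)

/-- The injective sequences with image `c.cols` are its increasing enumeration composed with
permutations, and the enumeration preserves inversions. -/
theorem qMinor_eq_listMinor {m n : ℕ} (q : Kˣ) (X : Matrix (Fin m) (Fin n) A)
    (c : Cortege m n) :
    qMinor q X c = listMinor (q : K) X (List.ofFn (c.rows.orderEmbOfFin rfl)) c.cols := by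
  unfold listMinor
  rw [List.map_ofFn]
  have h := prod_rowOp_vacuum (q := (q : K)) (fun d => X (c.rows.orderEmbOfFin rfl d)) c.cols
    c.cols subset_rfl
  refine Eq.trans ?_ h.symm
  rw [qMinor]
  refine Finset.sum_bij (fun σ _ d => c.cols.orderEmbOfFin c.card_eq.symm (σ d)) ?_ ?_ ?_ ?_
  · intro σ _
    simp only [Finset.mem_filter, Finset.mem_univ, true_and]
    refine ⟨(c.cols.orderEmbOfFin c.card_eq.symm).injective.comp σ.injective, ?_⟩
    have h1 := Finset.image_orderEmbOfFin_univ c.cols c.card_eq.symm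
    refine Eq.trans ?_ h1
    ext x
    simp only [Finset.mem_image, Finset.mem_univ, true_and]
    exact σ.exists_congr_left.trans (by simp)
  · intro σ _ τ _ h
    ext d
    exact congrArg _ ((c.cols.orderEmbOfFin c.card_eq.symm).injective (congrFun h d))
  · intro g hg
    simp only [Finset.mem_filter, Finset.mem_univ, true_and] at hg
    have hmem (d) : g d ∈ c.cols := hg.2 ▸ Finset.mem_image_of_mem g (Finset.mem_univ d)
    let e := c.cols.orderIsoOfFin c.card_eq.symm
    have hinj : Function.Injective fun d => e.symm ⟨g d, hmem d⟩ := fun d d' h =>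
      hg.1 (congrArg Subtype.val (e.symm.injective h))
    refine ⟨Equiv.ofBijective _ (Finite.injective_iff_bijective.1 hinj), Finset.mem_univ _, ?_⟩
    funext d
    change ((e (e.symm ⟨g d, hmem d⟩) : c.cols) : Fin n) = g d
    rw [OrderIso.apply_symm_apply]
  · intro σ _
    congr 2
    simp only [permLength, seqLength, OrderEmbedding.lt_iff_lt]

end Expansion

/-! ### Commutation exponents of interval values and of weights -/

section Exponents

/-- The exponent `β + δ - α - γ` for the corteges `π(a,b)` and `π(c,d)`, where
`min a b ≥ min c d` (in terms of indices starting with `1`). -/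
def intervalExponent (a b c d : ℕ) : ℤ :=
  (min (min c d) (c - a) : ℕ) + (min (min c d) (d - b) : ℕ)
   - (min (min c d) ((a - min a b) - (c - min c d)) : ℕ) -
       (min (min c d) ((b - min a b) - (d - min c d)) : ℕ)

/-- The exponent in the commutation of the values at `π(a,b)` and `π(c,d)`. -/
def pairExponent (a b c d : ℕ) : ℤ := if min c d ≤ min a b then intervalExponent a b c d else
    - intervalExponent c d a b

theorem intervalExponent_swap (a b c d : ℕ) :
    intervalExponent a b c d = intervalExponent b a d c := by
  unfold intervalExponent
  rw [min_comm d c, min_comm b a]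
  ring

theorem pairExponent_swap (a b c d : ℕ) : pairExponent a b c d = pairExponent b a d c := by
  unfold pairExponent
  rw [min_comm d c, min_comm b a, intervalExponent_swap, intervalExponent_swap c d]

/-- This and the next four lemmas give closed forms on regions bounded by weak inequalities. The
regions overlap, so that the four terms of a second difference can each be matched with a closed
form. -/
theorem pairExponent_of_ge_of_le {a b c d : ℕ} (h1 : a ≤ b) (h2 : c ≤ d) (h3 : c ≤ a) (h4 : b ≤ d) :
    pairExponent a b c d =
      (min c (d - b) : ℕ) := by
  unfold pairExponent intervalExponent
  rw [min_eq_left h1, min_eq_left h2, if_pos h3]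
  omega

theorem pairExponent_of_le_of_ge {a b c d : ℕ} (h1 : a ≤ b) (h2 : c ≤ d) (h3 : a ≤ c) (h4 : d ≤ b) :
    pairExponent a b c d =
      - (min a (b - d) : ℕ) := by
  unfold pairExponent intervalExponent
  rw [min_eq_left h1, min_eq_left h2]
  split_ifs <;> omega

theorem pairExponent_of_le_of_le {a b c d : ℕ} (h1 : a ≤ b) (h2 : c ≤ d) (h3 : a ≤ c) (h4 : b ≤ d) :
    pairExponent a b c d =
      (min a ((d - b) - (c - a)) : ℕ) := by
  unfold pairExponent intervalExponent
  rw [min_eq_left h1, min_eq_left h2]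
  split_ifs <;> omega

theorem pairExponent_cross_of_ge {a b c d : ℕ} (h1 : a ≤ b) (h2 : d ≤ c) (h3 : d ≤ a) :
    pairExponent a b c d =
      (min d (c - a) : ℕ) - (min d (b - a) : ℕ) := by
  unfold pairExponent intervalExponent
  rw [min_eq_left h1, min_eq_right h2, if_pos h3]
  omega

theorem pairExponent_cross_of_le {a b c d : ℕ} (h1 : a ≤ b) (h2 : d ≤ c) (h3 : a ≤ d) :
    pairExponent a b c d =
      (min a (c - d) : ℕ) - (min a (b - d) : ℕ) := by
  unfold pairExponent intervalExponent
  rw [min_eq_left h1, min_eq_right h2]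
  split_ifs <;> omega

/-- The exponent in the commutation of the weights of the vertices `(i+1,j+1)` and
`(k+1,l+1)`. -/
def weightExponent (i j k l : ℕ) : ℤ := pairExponent i j k l - pairExponent i j (k + 1) (l + 1)
    - pairExponent (i + 1) (j + 1) k l + pairExponent (i + 1) (j + 1) (k + 1) (l + 1)

theorem weightExponent_row_of_le {i j l : ℕ} (h1 : i ≤ j) (h : j < l) :
    weightExponent i j i l = 1 := by
  have e0 := @pairExponent_of_ge_of_le i j i l (by omega) (by omega) (by omega) (by omega)
  have e1 := @pairExponent_of_le_of_le i j (i + 1) (l + 1) (by omega) (by omega) (by omega)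
      (by omega)
  have e2 := @pairExponent_of_ge_of_le (i + 1) (j + 1) i l (by omega) (by omega) (by omega)
      (by omega)
  have e3 := @pairExponent_of_ge_of_le (i + 1) (j + 1) (i + 1) (l + 1) (by omega) (by omega)
      (by omega) (by omega)
  rw [weightExponent, e0, e1, e2, e3]
  clear e0 e1 e2 e3
  omega

theorem weightExponent_row_cross {i j l : ℕ} (h1 : j ≤ i) (h2 : i ≤ l) (h : j < l) :
    weightExponent j i l i = 1 := by
  have e0 := @pairExponent_cross_of_le j i l i (by omega) (by omega) (by omega)
  have e1 := @pairExponent_cross_of_le j i (l + 1) (i + 1) (by omega) (by omega) (by omega)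
  -- When `i = j` the shifted index `j + 1` exceeds `i`, and the other closed form applies; the
  -- final `omega` treats both alternatives.
  have e2 : pairExponent (j + 1) (i + 1) l i = (min (j + 1) (l - i) : ℕ) - 1 ∨
      i = j ∧ pairExponent (j + 1) (i + 1) l i = (min i (l - i-1) : ℕ) := by
    rcases h1.lt_or_eq with h1 | rfl
    · left
      rw [@pairExponent_cross_of_le (j + 1) (i + 1) l i (by omega) (by omega) (by omega)]
      omega
    · right
      rw [@pairExponent_cross_of_ge (j + 1) (j + 1) l j (by omega) (by omega) (by omega)]
      omega
  have e3 := @pairExponent_cross_of_le (j + 1) (i + 1) (l + 1) (i + 1) (by omega) (by omega)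
      (by omega)
  rw [weightExponent, e0, e1, e3]
  clear e0 e1 e3
  omega

theorem weightExponent_col_of_le {i j k : ℕ} (h1 : i ≤ j) (h2 : k ≤ j) (h : i < k) :
    weightExponent i j k j = 1 := by
  have e0 := @pairExponent_of_le_of_le i j k j (by omega) (by omega) (by omega) (by omega)
  have e1 := @pairExponent_of_le_of_le i j (k + 1) (j + 1) (by omega) (by omega) (by omega)
      (by omega)
  have e2 := @pairExponent_of_le_of_ge (i + 1) (j + 1) k j (by omega) (by omega) (by omega)
      (by omega)
  have e3 := @pairExponent_of_le_of_le (i + 1) (j + 1) (k + 1) (j + 1) (by omega) (by omega)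
      (by omega) (by omega)
  rw [weightExponent, e0, e1, e2, e3]
  clear e0 e1 e2 e3
  omega

theorem weightExponent_eq_zero_of_lt_of_lt {i j k l : ℕ} (h1 : i ≤ j) (h2 : k ≤ l) (h : i < k)
    (h4 : j < l) : weightExponent i j k l = 0 := by
  have e0 := @pairExponent_of_le_of_le i j k l (by omega) (by omega) (by omega) (by omega)
  have e1 := @pairExponent_of_le_of_le i j (k + 1) (l + 1) (by omega) (by omega) (by omega)
      (by omega)
  have e2 := @pairExponent_of_le_of_le (i + 1) (j + 1) k l (by omega) (by omega) (by omega)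
      (by omega)
  have e3 := @pairExponent_of_le_of_le (i + 1) (j + 1) (k + 1) (l + 1) (by omega) (by omega)
      (by omega) (by omega)
  rw [weightExponent, e0, e1, e2, e3]
  clear e0 e1 e2 e3
  omega

theorem weightExponent_eq_zero_of_lt_of_gt {i j k l : ℕ} (h1 : i ≤ j) (h2 : k ≤ l) (h : i < k)
    (h4 : l < j) : weightExponent i j k l = 0 := by
  have e0 := @pairExponent_of_le_of_ge i j k l (by omega) (by omega) (by omega) (by omega)
  have e1 := @pairExponent_of_le_of_ge i j (k + 1) (l + 1) (by omega) (by omega) (by omega)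
      (by omega)
  have e2 := @pairExponent_of_le_of_ge (i + 1) (j + 1) k l (by omega) (by omega) (by omega)
      (by omega)
  have e3 := @pairExponent_of_le_of_ge (i + 1) (j + 1) (k + 1) (l + 1) (by omega) (by omega)
      (by omega) (by omega)
  rw [weightExponent, e0, e1, e2, e3]
  clear e0 e1 e2 e3
  omega

theorem weightExponent_cross_of_lt {i j k l : ℕ} (h1 : i ≤ j) (h2 : l ≤ k) (h4 : j < l) :
    weightExponent i j k l = 0 := by
  have e0 := @pairExponent_cross_of_le i j k l (by omega) (by omega) (by omega)
  have e1 := @pairExponent_cross_of_le i j (k + 1) (l + 1) (by omega) (by omega) (by omega)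
  have e2 := @pairExponent_cross_of_le (i + 1) (j + 1) k l (by omega) (by omega) (by omega)
  have e3 := @pairExponent_cross_of_le (i + 1) (j + 1) (k + 1) (l + 1) (by omega) (by omega)
      (by omega)
  rw [weightExponent, e0, e1, e2, e3]
  clear e0 e1 e2 e3
  omega

theorem weightExponent_cross_of_gt_of_lt {i j k l : ℕ} (h1 : i ≤ j) (h2 : l ≤ k) (h4 : l < j)
    (h5 : i < l) : weightExponent i j k l = 0 := by
  have e0 := @pairExponent_cross_of_le i j k l (by omega) (by omega) (by omega)
  have e1 := @pairExponent_cross_of_le i j (k + 1) (l + 1) (by omega) (by omega) (by omega)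
  have e2 := @pairExponent_cross_of_le (i + 1) (j + 1) k l (by omega) (by omega) (by omega)
  have e3 := @pairExponent_cross_of_le (i + 1) (j + 1) (k + 1) (l + 1) (by omega) (by omega)
      (by omega)
  rw [weightExponent, e0, e1, e2, e3]
  clear e0 e1 e2 e3
  omega

theorem weightExponent_cross_of_gt_of_gt {i j k l : ℕ} (h1 : i ≤ j) (h2 : l ≤ k) (h : i < k)
    (h5 : l < i) : weightExponent i j k l = 0 := by
  have e0 := @pairExponent_cross_of_ge i j k l (by omega) (by omega) (by omega)
  have e1 := @pairExponent_cross_of_ge i j (k + 1) (l + 1) (by omega) (by omega) (by omega)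
  have e2 := @pairExponent_cross_of_ge (i + 1) (j + 1) k l (by omega) (by omega) (by omega)
  have e3 := @pairExponent_cross_of_ge (i + 1) (j + 1) (k + 1) (l + 1) (by omega) (by omega)
      (by omega)
  rw [weightExponent, e0, e1, e2, e3]
  clear e0 e1 e2 e3
  omega

theorem weightExponent_cross_of_gt {i j k : ℕ} (h1 : i ≤ j) (h : i < k) (h4 : i < j) :
    weightExponent i j k i = 0 := by
  have e0 := @pairExponent_cross_of_ge i j k i (by omega) (by omega) (by omega)
  have e1 := @pairExponent_cross_of_le i j (k + 1) (i + 1) (by omega) (by omega) (by omega)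
  have e2 := @pairExponent_cross_of_ge (i + 1) (j + 1) k i (by omega) (by omega) (by omega)
  have e3 := @pairExponent_cross_of_ge (i + 1) (j + 1) (k + 1) (i + 1) (by omega) (by omega)
      (by omega)
  rw [weightExponent, e0, e1, e2, e3]
  clear e0 e1 e2 e3
  omega

theorem weightExponent_swap (i j k l : ℕ) : weightExponent i j k l = weightExponent j i l k := by
  simp only [weightExponent, pairExponent_swap i, pairExponent_swap (i + 1)]

theorem weightExponent_row (i : ℕ) {j l : ℕ} (h : j < l) : weightExponent i j i l = 1 := by
  rcases le_total i j with h1 | h1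
  · exact weightExponent_row_of_le h1 h
  rw [weightExponent_swap]
  rcases le_total i l with h2 | h2
  · exact weightExponent_row_cross h1 h2 h
  · exact weightExponent_col_of_le h1 h2 h

theorem weightExponent_col {i k : ℕ} (j : ℕ) (h : i < k) : weightExponent i j k j = 1 := by
  rw [weightExponent_swap, weightExponent_row j h]

/-- A vanishing exponent in either order gives commutation, so the order can be chosen to suit the
closed forms. -/
theorem weightExponent_eq_zero {i j k l : ℕ} (h : i < k) (hjl : j ≠ l) :
    weightExponent i j k l = 0 ∨ weightExponent k l i j = 0 := by
  rcases lt_or_gt_of_ne hjl with hjl | hjl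
  · left
    rcases le_total i j with h1 | h1 <;> rcases le_total k l with h2 | h2
    · exact weightExponent_eq_zero_of_lt_of_lt h1 h2 h hjl
    · exact weightExponent_cross_of_lt h1 h2 hjl
    · rw [weightExponent_swap]
      exact weightExponent_cross_of_lt h1 h2 h
    · rw [weightExponent_swap]
      exact weightExponent_eq_zero_of_lt_of_lt h1 h2 hjl h
  · rcases le_total i j with h1 | h1
    · left
      rcases le_total k l with h2 | h2
      · exact weightExponent_eq_zero_of_lt_of_gt h1 h2 h hjl
      rcases lt_trichotomy i l with h3 | rfl | h3
      · exact weightExponent_cross_of_gt_of_lt h1 h2 hjl h3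
      · exact weightExponent_cross_of_gt h1 h hjl
      · exact weightExponent_cross_of_gt_of_gt h1 h2 h h3
    · right
      rw [weightExponent_swap]
      exact weightExponent_eq_zero_of_lt_of_gt (by omega) h1 hjl h

theorem pairExponent_eq_zero_of_left {a b : ℕ} (h : min a b = 0) (c d : ℕ) :
    pairExponent a b c d = 0 := by
  rw [pairExponent, h]
  split_ifs with h1
  · simp [intervalExponent, Nat.le_zero.1 h1]
  · simp [intervalExponent, h]

theorem pairExponent_eq_zero_of_right (a b : ℕ) {c d : ℕ} (h : min c d = 0) :
    pairExponent a b c d = 0 := by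
  rw [pairExponent, h, if_pos (Nat.zero_le _)]
  simp [intervalExponent, h]

theorem numAbove_intervalTo {k : ℕ} (i i' : Fin k) (d d' : ℕ) (h : d' ≤ i') :
    numAbove (intervalTo i d) (intervalTo i' d') = min (d' + 1) (i' - i) := by
  rw [numAbove, ← Finset.card_map Fin.valEmbedding]
  have : ((intervalTo i' d').filter fun t => ∀ s ∈ intervalTo i d, s < t).map Fin.valEmbedding
      = Finset.Ico (max (i' - d') (i + 1)) (i' + 1) := by
    ext x
    simp only [intervalTo, Finset.mem_map, Finset.mem_filter, Finset.mem_Icc, Finset.mem_Ico,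
      Fin.valEmbedding_apply, Fin.le_def, Fin.lt_def]
    constructor
    · rintro ⟨t, ⟨h1, h2⟩, rfl⟩
      have := h2 i ⟨by omega, le_rfl⟩
      omega
    · intro hx
      exact ⟨⟨x, by omega⟩, ⟨⟨by dsimp only; omega, by dsimp only; omega⟩,
        fun s hs => by dsimp only; omega⟩, rfl⟩
  rw [this, Nat.card_Ico]
  omega

theorem numBelow_intervalTo {k : ℕ} (i i' : Fin k) (d d' : ℕ) (h : d' ≤ i') :
    numBelow (intervalTo i d) (intervalTo i' d') = min (d' + 1) ((i - d) - (i' - d')) := by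
  rw [numBelow, ← Finset.card_map Fin.valEmbedding]
  have : ((intervalTo i' d').filter fun t => ∀ s ∈ intervalTo i d, t < s).map Fin.valEmbedding
      = Finset.Ico (i' - d' : ℕ) (min (i' + 1) (i - d)) := by
    ext x
    simp only [intervalTo, Finset.mem_map, Finset.mem_filter, Finset.mem_Icc, Finset.mem_Ico,
      Fin.valEmbedding_apply, Fin.le_def, Fin.lt_def]
    constructor
    · rintro ⟨t, ⟨h1, h2⟩, rfl⟩
      have := h2 ⟨i - d, by omega⟩ ⟨le_rfl, by dsimp only; omega⟩
      dsimp only at this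
      omega
    · intro hx
      exact ⟨⟨x, by omega⟩, ⟨⟨by dsimp only; omega, by dsimp only; omega⟩,
        fun s hs => by dsimp only; omega⟩, rfl⟩
  rw [this, Nat.card_Ico]
  omega

theorem qcExponent_pressedAt {m n : ℕ} (i i' : Fin m) (j j' : Fin n) :
    qcExponent (pressedAt i j).1 (pressedAt i' j').1
      = intervalExponent (i + 1) (j + 1) (i' + 1) (j' + 1) := by
  simp only [qcExponent, pressedAt, intervalExponent,
    numAbove_intervalTo _ _ _ _ (min_le_left (i' : ℕ) j'),
    numAbove_intervalTo _ _ _ _ (min_le_right (i' : ℕ) j'),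
    numBelow_intervalTo _ _ _ _ (min_le_left (i' : ℕ) j'),
    numBelow_intervalTo _ _ _ _ (min_le_right (i' : ℕ) j'),
    Nat.add_min_add_right, Nat.add_sub_add_right]

end Exponents

/-! ### Commutation of the weights and pressed minors of the path matrix -/

section Weights

variable {K : Type u} [Field K] {A : Type v} [Ring A] [Algebra K A]

/-- `x` and `y` commute up to the factor `q ^ s`. -/
def UnitsQComm (q : Kˣ) (s : ℤ) (x y : Aˣ) : Prop :=
  (x : A) * y = ((q ^ s : Kˣ) : K) • ((y : A) * x)

namespace UnitsQComm

variable {q : Kˣ} {s t : ℤ} {x y z : Aˣ}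

theorem symm (h : UnitsQComm q s x y) : UnitsQComm q (-s) y x := by
  rw [UnitsQComm, h, smul_smul, ← Units.val_mul (q ^ (-s)), ← zpow_add, neg_add_cancel, zpow_zero,
    Units.val_one, one_smul]

theorem mul_left (hx : UnitsQComm q s x z) (hy : UnitsQComm q t y z) :
    UnitsQComm q (s + t) (x * y) z := by
  rw [UnitsQComm, Units.val_mul, mul_assoc, hy, mul_smul_comm, ← mul_assoc, hx, smul_mul_assoc,
    smul_smul, ← Units.val_mul (q ^ t), ← zpow_add, add_comm t, mul_assoc]

theorem inv_left (h : UnitsQComm q s x z) : UnitsQComm q (-s) x⁻¹ z := by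
  have h1 := congrArg (fun a => ((x⁻¹ : Aˣ) : A) * a * ((x⁻¹ : Aˣ) : A)) h.symm
  simp only [mul_smul_comm, smul_mul_assoc, mul_assoc, Units.inv_mul_cancel_left,
    Units.mul_inv, mul_one] at h1
  exact h1

theorem mul_right (hx : UnitsQComm q s z x) (hy : UnitsQComm q t z y) :
    UnitsQComm q (s + t) z (x * y) := by
  have := (hx.symm.mul_left hy.symm).symm
  rwa [neg_add, neg_neg, neg_neg] at this

theorem inv_right (h : UnitsQComm q s z x) : UnitsQComm q (-s) z x⁻¹ := by
  simpa only [neg_neg] using h.symm.inv_left.symm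

theorem one_left : UnitsQComm q 0 1 x := by simp [UnitsQComm]

theorem one_right : UnitsQComm q 0 x 1 := by simp [UnitsQComm]

end UnitsQComm

variable {m n : ℕ}

/-- The values of `f₀` at the corteges `π(a,b)`, with value `1` on the boundary. -/
def pressedValue (f₀ : Pint m n → Aˣ) (a b : ℕ) : Aˣ :=
  if h : (0 < a ∧ a ≤ m) ∧ 0 < b ∧ b ≤ n then
    f₀ (pressedAt ⟨a - 1, by omega⟩ ⟨b - 1, by omega⟩) else 1

theorem pressedValue_of_min_eq_zero (f₀ : Pint m n → Aˣ) {a b : ℕ} (h : min a b = 0) :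
    pressedValue f₀ a b = 1 := dif_neg (by omega)

theorem pressedValue_succ (f₀ : Pint m n → Aˣ) (i : Fin m) (j : Fin n) :
    pressedValue f₀ (i + 1) (j + 1) = f₀ (pressedAt i j) := by
  rw [pressedValue, dif_pos (by omega)]
  rfl

theorem vertexWeight_eq (f₀ : Pint m n → Aˣ) (i : Fin m) (j : Fin n) :
    vertexWeight f₀ i j = (pressedValue f₀ i j)⁻¹ * pressedValue f₀ (i + 1) (j + 1) := by
  rw [pressedValue_succ, vertexWeight]
  split_ifs with h
  · rw [pressedValue, dif_pos (by omega)]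
  · rw [pressedValue_of_min_eq_zero f₀ (by omega), inv_one, one_mul]

variable {q : Kˣ} {f₀ : Pint m n → Aˣ}

theorem QuasiCommutes.pressedValue (hf₀ : QuasiCommutes q f₀) {a b c d : ℕ} (ha : a ≤ m)
    (hb : b ≤ n) (hc : c ≤ m) (hd : d ≤ n) :
    UnitsQComm q (pairExponent a b c d) (pressedValue f₀ a b) (pressedValue f₀ c d) := by
  by_cases h : min a b = 0
  · rw [pairExponent_eq_zero_of_left h, pressedValue_of_min_eq_zero f₀ h]
    exact UnitsQComm.one_left
  by_cases h' : min c d = 0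
  · rw [pairExponent_eq_zero_of_right a b h', pressedValue_of_min_eq_zero f₀ h']
    exact UnitsQComm.one_right
  obtain ⟨i, rfl⟩ : ∃ i : Fin m, a = i + 1 := ⟨⟨a - 1, by omega⟩, by dsimp only; omega⟩
  obtain ⟨j, rfl⟩ : ∃ j : Fin n, b = j + 1 := ⟨⟨b - 1, by omega⟩, by dsimp only; omega⟩
  obtain ⟨k, rfl⟩ : ∃ i : Fin m, c = i + 1 := ⟨⟨c - 1, by omega⟩, by dsimp only; omega⟩
  obtain ⟨l, rfl⟩ : ∃ j : Fin n, d = j + 1 := ⟨⟨d - 1, by omega⟩, by dsimp only; omega⟩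
  have hcard (i : Fin m) (j : Fin n) : (pressedAt i j).1.rows.card = min (i : ℕ) j + 1 :=
    intervalTo_card _ _ (min_le_left _ _)
  rw [pressedValue_succ, pressedValue_succ, pairExponent]
  split_ifs with hle
  · rw [← qcExponent_pressedAt]
    exact hf₀ _ _ (by rw [hcard, hcard]; omega)
  · rw [← qcExponent_pressedAt]
    exact UnitsQComm.symm (hf₀ _ _ (by rw [hcard, hcard]; omega))

/-- Exponents add under products and change sign under inverses, so two quotients give a mixed
second difference. The boundary value 1 has exponent 0 and needs no separate case. -/
theorem QuasiCommutes.vertexWeight (hf₀ : QuasiCommutes q f₀) (i k : Fin m) (j l : Fin n) :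
    UnitsQComm q (weightExponent i j k l) (vertexWeight f₀ i j) (vertexWeight f₀ k l) := by
  rw [vertexWeight_eq, vertexWeight_eq]
  have h1 := hf₀.pressedValue (a := i) (b := j) (c := k) (d := l) (by omega) (by omega) (by omega)
    (by omega)
  have h2 := hf₀.pressedValue (a := i) (b := j) (c := k + 1) (d := l + 1) (by omega) (by omega)
    (by omega) (by omega)
  have h3 := hf₀.pressedValue (a := i + 1) (b := j + 1) (c := k) (d := l) (by omega) (by omega)
    (by omega) (by omega)
  have h4 := hf₀.pressedValue (a := i + 1) (b := j + 1) (c := k + 1) (d := l + 1) (by omega)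
    (by omega) (by omega) (by omega)
  have h := (h1.inv_left.inv_right.mul_right h2.inv_left).mul_left (h3.inv_right.mul_right h4)
  rw [weightExponent]
  convert h using 1
  ring

theorem QuasiCommutes.partFine (hf₀ : QuasiCommutes q f₀) :
    PartFine (q : K) ∅ fun i j => (QuantumMinors.vertexWeight f₀ i j : A) := by
  have hcomm : ∀ {i l : Fin m} {j k : Fin n}, i < l → j ≠ k →
      (QuantumMinors.vertexWeight f₀ i j : A) * QuantumMinors.vertexWeight f₀ l k
        = QuantumMinors.vertexWeight f₀ l k * QuantumMinors.vertexWeight f₀ i j := by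
    intro i l j k hil hjk
    have h1 := hf₀.vertexWeight i l j k
    have h2 := hf₀.vertexWeight l i k j
    rcases weightExponent_eq_zero (Fin.lt_def.1 hil) (fun h => hjk (Fin.ext h)) with h | h
    · rw [h, UnitsQComm, zpow_zero, Units.val_one, one_smul] at h1
      exact h1
    · rw [h, UnitsQComm, zpow_zero, Units.val_one, one_smul] at h2
      exact h2.symm
  refine ⟨fun i j k hjk => ?_, fun {i l} j hil => ?_, fun hil hjk => hcomm hil hjk.ne',
    fun _ _ h => absurd h (Set.notMem_empty _), fun hil hjk _ => hcomm hil hjk.ne⟩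
  · have h := hf₀.vertexWeight i i j k
    rwa [weightExponent_row i (Fin.lt_def.1 hjk), UnitsQComm, zpow_one] at h
  · have h := hf₀.vertexWeight i l j j
    rwa [weightExponent_col j (Fin.lt_def.1 hil), UnitsQComm, zpow_one] at h

theorem PartFine.isFine {X : Matrix (Fin m) (Fin n) A} {S : Set (Fin m × Fin n)}
    (h : PartFine (q : K) S X) (hS : ∀ x, x ∈ S) : IsFine q X where
  row i _ _ hjk := h.row i hjk
  col _ _ j hil := h.col j hil
  anti _ _ _ _ hil hjk := h.anti hil hjk
  diag _ _ _ _ hil hjk := by rw [h.diag hil hjk (hS _), add_sub_cancel_left]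

theorem pathMatrix_partFine {w : Fin m → Fin n → Aˣ}
    (hw : PartFine (q : K) ∅ fun i j => (w i j : A)) :
    stage w m = pathMatrix w ∧ IsFine q (pathMatrix w) := by
  have h : stage w m = pathMatrix w := funext fun i => funext fun j => stage_last_eq_pathMatrix w
      i j
  refine ⟨h, ?_⟩
  rw [← h]
  exact (stage_partFine hw q.ne_zero le_rfl).isFine fun x => Nat.le_add_left _ _

theorem prod_inv_mul_telescope {G : Type*} [Group G] (F : ℕ → ℕ → G) (k r c : ℕ) :
    (List.ofFn fun d : Fin k => (F (r + d) (c + d))⁻¹ * F (r + d + 1) (c + d + 1)).prod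
      = (F r c)⁻¹ * F (r + k) (c + k) := by
  induction k with
  | zero => simp
  | succ k ih =>
    rw [List.ofFn_succ', List.prod_concat]
    simp only [Fin.val_castSucc, Fin.val_last]
    rw [ih]
    simp only [add_assoc, mul_assoc, mul_inv_cancel_left]

theorem ofFn_orderEmbOfFin_Icc {a b : Fin m} {k : ℕ} (hab : a ≤ b) (hk : a + k = b.1 + 1)
    {S : Finset (Fin m)} (hS : S = Finset.Icc a b) :
    List.ofFn (S.orderEmbOfFin rfl) = rowList a k (by omega) := by
  have hcard : S.card = k := by
    rw [hS, Fin.card_Icc]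
    omega
  have hmem (x : Fin m) : x ∈ S ↔ a ≤ x ∧ x ≤ b := by rw [hS, Finset.mem_Icc]
  subst hcard
  rw [rowList]
  congr 1
  symm
  refine Finset.orderEmbOfFin_unique rfl (fun d => ?_) fun d e hde => ?_
  · rw [hmem, Fin.le_def, Fin.le_def]
    dsimp only
    omega
  · rw [Fin.lt_def] at hde ⊢
    dsimp only
    omega

theorem IsInitial.eq_zero {a b : Fin m} (hab : a ≤ b) {S : Finset (Fin m)}
    (hS : S = Finset.Icc a b) (h : IsInitial S) : a.1 = 0 := by
  have h0 : 0 < S.card := Finset.card_pos.2 ⟨a, by simp [hS, hab]⟩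
  have h1 := (h ⟨0, a.pos⟩).2 h0
  rw [hS, Finset.mem_Icc, Fin.le_def] at h1
  exact Nat.le_zero.1 h1.1

/-- A pressed cortege is determined by its last row and last column, so it is some `pressedAt b b'`;
the weights on its diagonal telescope to the value there. -/
theorem qMinor_pathMatrix_pressed (hf₀ : QuasiCommutes q f₀) (c : Pint m n) :
    qMinor q (pathMatrix (QuantumMinors.vertexWeight f₀)) c.1 = (f₀ c : A) := by
  obtain ⟨c, hr, hc, hi⟩ := c
  obtain ⟨a, b, hab, hrows⟩ := hr
  obtain ⟨a', b', hab', hcols⟩ := hc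
  have hcard := c.card_eq
  have hab1 := Fin.le_def.1 hab
  have hab2 := Fin.le_def.1 hab'
  rw [hrows, hcols, Fin.card_Icc, Fin.card_Icc] at hcard
  have h0 : a.1 = 0 ∨ a'.1 = 0 := hi.imp (IsInitial.eq_zero hab hrows)
      (IsInitial.eq_zero hab' hcols)
  obtain ⟨k, hk⟩ : ∃ k, a + k = b.1 + 1 := ⟨b + 1 - a, by omega⟩
  have hk' : a' + k = b'.1 + 1 := by omega
  have hcols' : c.cols = colSet n a' k := by
    ext x
    rw [hcols, mem_colSet, Finset.mem_Icc, Fin.le_def, Fin.le_def]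
    omega
  have hpress : pressedAt b b' =
      (⟨c, ⟨a, b, hab, hrows⟩, ⟨a', b', hab', hcols⟩, hi⟩ : Pint m n) := by
    refine Subtype.ext (Cortege.ext ?_ ?_)
    · rw [hrows]
      change Finset.Icc _ _ = _
      congr 1
      exact Fin.ext (by dsimp only; omega)
    · rw [hcols]
      change Finset.Icc _ _ = _
      congr 1
      exact Fin.ext (by dsimp only; omega)
  refine Eq.trans ?_ (congrArg (fun x => (f₀ x : A)) hpress)
  dsimp only
  rw [qMinor_eq_listMinor, ofFn_orderEmbOfFin_Icc hab hk hrows, hcols',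
    ← (pathMatrix_partFine hf₀.partFine).1,
    listMinor_stage_last hf₀.partFine q.ne_zero (by omega) (by omega) h0,
    ← pressedValue_succ f₀ b b', ← hk, ← hk']
  have h := prod_inv_mul_telescope (pressedValue f₀) k a a'
  -- The diagonal starts on the boundary because `a` or `a'` is 0, so the first factor of the
  -- telescoped product is 1.
  rw [pressedValue_of_min_eq_zero f₀ (by omega), inv_one, one_mul] at h
  rw [← h, ← Units.coeHom_apply, map_list_prod, List.map_ofFn]
  congr 2
  funext d
  simp only [vertexWeight_eq, Function.comp_apply, Units.coeHom_apply]

theorem qMinor_empty (q : Kˣ) (X : Matrix (Fin m) (Fin n) A) :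
    qMinor q X (Cortege.empty m n) = 1 := by
  rw [qMinor_eq_listMinor]
  exact listMinor_nil X

end Weights

end QuantumMinors

open QuantumMinors
theorem theorem2 {K : Type u} [Field K] {A : Type v} [Ring A] [Algebra K A] (q : Kˣ)
    (m n : ℕ) (f₀ : Pint m n → Aˣ) (hf₀ : QuasiCommutes q f₀) :
    ∃ f : Cortege m n → A,
      IsQIFunction q f ∧
      (∀ c : Pint m n, f c.1 = (f₀ c : A)) ∧
      (∀ c : Cortege m n, f c = qMinor q (pathMatrix (vertexWeight f₀)) c) :=
  ⟨qMinor q (pathMatrix (vertexWeight f₀)),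
    ⟨qMinor_empty q _, fun _ hL => hL.2 A q _ (pathMatrix_partFine hf₀.partFine).2⟩,
    qMinor_pathMatrix_pressed hf₀, fun _ => rfl⟩
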